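/- Let $d\ge 1$, $r\ge 0$, $n\ge 1$ be integers and let $\mathcal W=[v]$ be a $d$-web of degree $r$ on the complex projective plane, given by a section $v\in H^0(\mathbb P^2,\mathrm{Sym}^d T\mathbb P^2\otimes\mathcal O(r-d))$. Let $s_0,\dots,s_k$ be a basis of $H^0(\mathbb P^2,\mathcal O(n))$, so that $k=n(n+3)/2$. For a local holomorphic vector field $w$ put $\sigma_W(w)=\det\big(w^{a}(s_b)\big)_{0\le a,b\le k}$, where the $s_b$ are read as functions in a local trivialization of $\mathcal O(n)$ and $w^{a}$ is the $a$-fold derivative along $w$. Locally outside the zero set of the discriminant $\Delta(v)$, write $v=w_1\cdots w_d$ with holomorphic vector fields $w_j$ (in a local trivialization of $\mathcal O(r-d)$); there $\Delta(v)=\prod_{i<j}(w_i\wedge w_j)^2$, and one sets $\sigma_W(v)=\prod_j\sigma_W(w_j)$. The $n$-th extactic divisor $\mathcal E_n(\mathcal W)$ is the divisor defined by the vanishing of $\Delta(v)^{k(k-1)/2}\cdot\sigma_W(v)$, extended across the zero set of $\Delta(v)$ (it is all of $\mathbb P^2$ if this expression vanishes identically). If $\mathcal E_n(\mathcal W)\ne\mathbb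 P^2$, then this expression extends holomorphically and $\mathcal E_n(\mathcal W)$ is a curve (an effective divisor, components being counted with multiplicity) of degree $$\frac n8\Big[(n+1)(n+2)\big(4d+(n+3)(r-d)\big)+(n+3)(n^2+3n-2)(d-1)(d+2r)\Big].$$ -/

import Mathlib

/-!
# Extactic divisors of webs on the complex projective plane

The projective plane is described by its three standard affine charts `U_i = {X_i ≠ 0}`, each
identified with `ℂ²` by the quotients `X_l / X_i`, `l ≠ i`.  Line bundles and symmetric powers of
the tangent bundle are given by their trivializations over these charts: the line bundle `O(e)` is
trivialized over `U_i` by `X_i ^ e`, the tangent bundle by the coordinate vector fields.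
-/

namespace Extactic

open Filter Topology MvPolynomial

/-- The standard affine chart `ℂ² → {X_i = 1} ⊆ ℂ³` of `ℙ²`: the homogeneous coordinates, with
`X_i = 1`, of the point of `U_i` with affine coordinates `p`. -/
def chartPt (i : Fin 3) (p : Fin 2 → ℂ) : Fin 3 → ℂ :=
  i.insertNth (α := fun _ => ℂ) 1 p

/-- The change of coordinates from the chart `U_i` to the chart `U_j`; it is meaningful at the
points `p` with `chartPt i p j ≠ 0`, which are the points of `U_i ∩ U_j`. -/
noncomputable def transition (i j : Fin 3) (p : Fin 2 → ℂ) : Fin 2 → ℂ :=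
  fun l => chartPt i p (j.succAbove l) / chartPt i p j

/-- The push-forward of symmetric tensors under the differential at `p` of the change of
coordinates from `U_i` to `U_j`.  A symmetric `d`-vector is written as a homogeneous polynomial of
degree `d` in the coordinate vectors `X 0 = ∂/∂x₀`, `X 1 = ∂/∂x₁`. -/
noncomputable def pushSym (i j : Fin 3) (p : Fin 2 → ℂ) :
    MvPolynomial (Fin 2) ℂ →ₐ[ℂ] MvPolynomial (Fin 2) ℂ :=
  aeval fun l => ∑ m, C (fderiv ℂ (transition i j) p (Pi.single l 1) m) * X m

/-- The value at the point `p` of a symmetric vector field on `ℂ²`.  The coefficients (inner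
polynomials) are functions of the affine coordinates, the outer variables are the coordinate
vector fields. -/
noncomputable def valueAt (u : MvPolynomial (Fin 2) (MvPolynomial (Fin 2) ℂ)) (p : Fin 2 → ℂ) :
    MvPolynomial (Fin 2) ℂ :=
  MvPolynomial.map (eval p) u

/-- A global section of `Sym^d Tℙ² ⊗ O(e)` on the complex projective plane: on every chart `U_i`
a regular section `loc i` of `Sym^d T`, the section being `loc i ⊗ X_i ^ e` there, such that the
local expressions agree on the overlaps. -/
structure SymSection (d : ℕ) (e : ℤ) where
  /-- the local expressions -/
  loc : Fin 3 → MvPolynomial (Fin 2) (MvPolynomial (Fin 2) ℂ)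
  homogeneous : ∀ i, (loc i).IsHomogeneous d
  compatible : ∀ i j p, chartPt i p j ≠ 0 →
    pushSym i j p (valueAt (loc i) p) =
      C (chartPt i p j ^ e) * valueAt (loc j) (transition i j p)

/-- A symmetric vector field defining a `d`-web of degree `r` on `ℙ²`: a section of
`Sym^d Tℙ² ⊗ O(r - d)`. -/
abbrev WebSection (d r : ℕ) := SymSection d ((r : ℤ) - (d : ℤ))

/-- The action of a vector field `w` on functions, `f ↦ w(f)`. -/
noncomputable def act (w : (Fin 2 → ℂ) → (Fin 2 → ℂ)) (f : (Fin 2 → ℂ) → ℂ) : (Fin 2 → ℂ) → ℂ :=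
  fun q => fderiv ℂ f q (w q)

/-- The expression over `U_i` of a section of `O(n)`, that is of a homogeneous polynomial of degree
`n`, in the trivialization `X_i ^ n`. -/
noncomputable def localExpr (i : Fin 3) (F : MvPolynomial (Fin 3) ℂ) : (Fin 2 → ℂ) → ℂ :=
  fun q => eval (chartPt i q) F

/-- The action of the jet differential `σ_W` on a vector field `w` over the chart `U_i`, where `s`
is a basis of `W = H⁰(ℙ², O(n))`: the determinant of the matrix whose rows are the `a`-fold
derivatives along `w`, for `a = 0, …, k`, of the local expressions of `s_0, …, s_k`. -/
noncomputable def sigma {n k : ℕ}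
    (s : Module.Basis (Fin (k + 1)) ℂ (homogeneousSubmodule (Fin 3) ℂ n))
    (i : Fin 3) (w : (Fin 2 → ℂ) → (Fin 2 → ℂ)) (p : Fin 2 → ℂ) : ℂ :=
  Matrix.det (Matrix.of fun a b : Fin (k + 1) =>
    ((act w)^[(a : ℕ)] (localExpr i (s b : MvPolynomial (Fin 3) ℂ))) p)

/-- `w 0, …, w (d - 1)` are holomorphic vector fields near the point `p` of the chart `U_i` and
`v = w 0 ⋯ w (d - 1)` near `p`. -/
structure IsDecomposition {d : ℕ} {e : ℤ} (v : SymSection d e) (i : Fin 3) (p : Fin 2 → ℂ)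
    (w : Fin d → (Fin 2 → ℂ) → (Fin 2 → ℂ)) : Prop where
  analytic : ∀ a, AnalyticAt ℂ (w a) p
  prod_eq : ∀ᶠ q in 𝓝 p, ∏ a, (∑ l, C (w a q l) * X l) = valueAt (v.loc i) q

/-- The discriminant at `p` of the product of the vector fields `w 0, …, w (d - 1)`, that is
`∏_{a < b} (w a ∧ w b)²`. -/
def disc {d : ℕ} (w : Fin d → (Fin 2 → ℂ) → (Fin 2 → ℂ)) (p : Fin 2 → ℂ) : ℂ :=
  ∏ a, ∏ b ∈ Finset.Ioi a, (w a p 0 * w b p 1 - w a p 1 * w b p 0) ^ 2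

/-- The value at `p`, over the chart `U_i`, of `Δ(v)^{k(k-1)/2} · σ_W(v)`, computed with the
decomposition `v = w 0 ⋯ w (d - 1)`, where `σ_W(v) = ∏ σ_W(w a)`. -/
noncomputable def extacticValue {d n k : ℕ}
    (s : Module.Basis (Fin (k + 1)) ℂ (homogeneousSubmodule (Fin 3) ℂ n))
    (i : Fin 3) (w : Fin d → (Fin 2 → ℂ) → (Fin 2 → ℂ)) (p : Fin 2 → ℂ) : ℂ :=
  disc w p ^ (k * (k - 1) / 2) * ∏ a, sigma s i (w a) p

/-- The section `Δ(v)^{k(k-1)/2} · σ_W(v)` vanishes identically, so that the extactic divisor is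
all of `ℙ²`. -/
def ExtacticVanishes {d n k : ℕ} {e : ℤ} (v : SymSection d e)
    (s : Module.Basis (Fin (k + 1)) ℂ (homogeneousSubmodule (Fin 3) ℂ n)) : Prop :=
  ∀ i p w, IsDecomposition v i p w → extacticValue s i w p = 0

/-- The regular function `g` on the chart `U_i` is the extension of
`Δ(v)^{k(k-1)/2} · σ_W(v)`, which is computed by local decompositions of `v` at the points where
the discriminant does not vanish. -/
def IsExtacticEquation {d n k : ℕ} {e : ℤ} (v : SymSection d e)
    (s : Module.Basis (Fin (k + 1)) ℂ (homogeneousSubmodule (Fin 3) ℂ n))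
    (i : Fin 3) (g : MvPolynomial (Fin 2) ℂ) : Prop :=
  ∀ p w, IsDecomposition v i p w → disc w p ≠ 0 → eval p g = extacticValue s i w p

/-- A plane projective curve, possibly with multiple components (an effective divisor on `ℙ²`):
the zero divisor of a nonzero homogeneous polynomial, which it determines up to a constant. -/
structure PlaneCurve where
  /-- the defining polynomial -/
  poly : MvPolynomial (Fin 3) ℂ
  /-- the degree of the curve -/
  degree : ℕ
  homogeneous : poly.IsHomogeneous degree
  ne_zero : poly ≠ 0

/-- The equation on the chart `U_i` of the curve defined by the homogeneous polynomial `F`. -/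
noncomputable def dehomogenize (i : Fin 3) :
    MvPolynomial (Fin 3) ℂ →ₐ[ℂ] MvPolynomial (Fin 2) ℂ :=
  aeval (i.insertNth (α := fun _ => MvPolynomial (Fin 2) ℂ) 1 X)

/-- The curve `E` is the divisor defined by the vanishing of `Δ(v)^{k(k-1)/2} · σ_W(v)`: on each
chart this section extends to a regular function which is an equation of `E`, multiplicities
included. -/
def IsExtacticDivisor {d n k : ℕ} {e : ℤ} (v : SymSection d e)
    (s : Module.Basis (Fin (k + 1)) ℂ (homogeneousSubmodule (Fin 3) ℂ n))
    (E : PlaneCurve) : Prop :=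
  ∀ i, ∃ g, IsExtacticEquation v s i g ∧ Associated (dehomogenize i E.poly) g

end Extactic

/-!
# The degree of the extactic divisor of a web

On a chart, regard the local expression of the web as a polynomial function `V` on the cotangent
bundle (`symbol`), homogeneous of degree `d` in the covector `ξ`. If `v = w_0 ⋯ w_{d-1}`, then `V`
vanishes on the covectors `ξ_a = (w_a¹, -w_a⁰)` annihilating `w_a`, and there the Hamiltonian vector
field `H` of `V` lies over `δ_a w_a`, where `δ_a = ∏_{b ≠ a} w_b(ξ_a)`; for a function `F` of degree
`e` in `ξ` one finds `(H F)(ξ_a) = δ_a w_a(F(ξ_a)) - e δ_a div(w_a) F(ξ_a)` (`eval_hamiltonian`).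

Consider the determinant `G` with rows `s_b`, `D s_b`, `H D s_b`, …, `H^{k-1} D s_b`, where
`D = ξ_0 ∂_1 - ξ_1 ∂_0` restricts to `w_a` at `ξ_a`. On `ξ = ξ_a` its rows are, up to a triangular
change with diagonal entries `1, 1, δ_a, δ_a², …` (`det_of_ladder`), the rows of `σ_W(w_a)`. Hence
`G(ξ_a) = δ_a^{k(k-1)/2} σ_W(w_a)` (`eval_charDet`). It is because the derivation starts with `D`
instead of `H` that the exponent is `k(k-1)/2`. As `∏ δ_a = ± Δ(v)`, the extactic section is
`± ∏_a G(ξ_a)`, which is the resultant of the binary forms `V` and `G`, a polynomial in the affine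
coordinates (`exists_eval_eq_extacticValue`). So the extactic section is regular on every chart,
including along the discriminant.

Under a change of charts, a decomposition is pushed forward, the factor `X_j ^ (-e)` of the
trivialization of `O(e)`, `e = r - d`, being absorbed in one of the `w_a`. The triangular argument
also gives `σ_W(h w) = h^{k(k+1)/2} σ_W(w)` and the effect of the trivialization of `O(n)`, and the
Jacobian contributes `X_j ^ (-3)` to each factor `w_a ∧ w_b`; so the extactic section is a section
of `O(N)` (`exists_transport`) with
`N = k(k-1)/2 · (d-1)(2e+3d) + k(k+1)/2 · e + d n (k+1)`.
Regular functions on the charts that glue in this way come from a homogeneous polynomial of degree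
`N` (`exists_isHomogeneous_of_gluing`), and it remains to insert `k + 1 = (n+1)(n+2)/2`.
-/

namespace Extactic

open Filter Topology MvPolynomial

/-! ### Resultants with products of linear forms, and the dimension of `H⁰(ℙ², O(n))` -/

/-- Multiplicativity of the resultant for formal degrees, which may exceed the actual ones. -/
theorem resultant_mul_left_of_le {K : Type*} [Field K] {f₁ f₂ g : Polynomial K} {m₁ m₂ n : ℕ}
    (h₁ : f₁.natDegree ≤ m₁) (h₂ : f₂.natDegree ≤ m₂) (hg : g.natDegree ≤ n) :
    Polynomial.resultant (f₁ * f₂) g (m₁ + m₂) n =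
      Polynomial.resultant f₁ g m₁ n * Polynomial.resultant f₂ g m₂ n := by
  rcases Nat.eq_zero_or_pos n with rfl | hn
  · simp [pow_add]
  rcases eq_or_ne f₁ 0 with rfl | h10
  · rw [zero_mul, Polynomial.resultant_zero_left, Polynomial.resultant_zero_left, zero_pow hn.ne']
    simp
  rcases eq_or_ne f₂ 0 with rfl | h20
  · rw [mul_zero, Polynomial.resultant_zero_left, Polynomial.resultant_zero_left, zero_pow hn.ne']
    simp
  obtain ⟨s, rfl⟩ := Nat.exists_eq_add_of_le h₁
  obtain ⟨t, rfl⟩ := Nat.exists_eq_add_of_le h₂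
  rw [show f₁.natDegree + s + (f₂.natDegree + t) = f₁.natDegree + f₂.natDegree + (s + t) by ring,
    Polynomial.resultant_add_left_deg _ _ _ _ _ Polynomial.natDegree_mul_le,
    Polynomial.resultant_mul_left _ _ _ _ hg,
    Polynomial.resultant_add_left_deg f₁ _ _ _ _ le_rfl,
    Polynomial.resultant_add_left_deg f₂ _ _ _ _ le_rfl]
  ring

/-- The resultant with the linear form `x T + y` is the value at `(-y, x)` of the binary form of
degree `n` defined by `g`; this includes the root at infinity, `x = 0`. -/
theorem resultant_linear_left {K : Type*} [Field K] (x y : K) {g : Polynomial K} {n : ℕ}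
    (hg : g.natDegree ≤ n) :
    Polynomial.resultant (Polynomial.C x * Polynomial.X + Polynomial.C y) g 1 n =
      ∑ l ∈ Finset.range (n + 1), g.coeff l * (-y) ^ l * x ^ (n - l) := by
  rcases eq_or_ne x 0 with rfl | hx
  · rw [Finset.sum_range_succ, Finset.sum_eq_zero]
    · rw [Polynomial.C_0, zero_mul, zero_add, Polynomial.resultant_C_left, neg_pow y, Nat.sub_self]
      ring
    · intro l hl
      rw [zero_pow (by have := Finset.mem_range.1 hl; omega), mul_zero]
  · have : Polynomial.C x * Polynomial.X + Polynomial.C y =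
        Polynomial.C x * (Polynomial.X + Polynomial.C (y / x)) := by
      rw [mul_add, ← Polynomial.C_mul, mul_div_cancel₀ _ hx]
    rw [this, Polynomial.resultant_C_mul_left, Polynomial.resultant_X_add_C_left _ _ _ hg,
      Polynomial.eval_eq_sum_range' (Nat.lt_succ_of_le hg), Finset.mul_sum]
    refine Finset.sum_congr rfl fun l hl => ?_
    have hl' : l ≤ n := Nat.lt_succ_iff.1 (Finset.mem_range.1 hl)
    rw [← Nat.sub_add_cancel hl', pow_add, Nat.add_sub_cancel, ← neg_div, div_pow]
    field_simp

theorem resultant_prod_linear_left {K ι : Type*} [Field K] (s : Finset ι) (x y : ι → K)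
    {g : Polynomial K} {n : ℕ} (hg : g.natDegree ≤ n) :
    Polynomial.resultant (∏ a ∈ s, (Polynomial.C (x a) * Polynomial.X + Polynomial.C (y a))) g
        s.card n =
      ∏ a ∈ s, ∑ l ∈ Finset.range (n + 1), g.coeff l * (-y a) ^ l * x a ^ (n - l) := by
  classical
  induction s using Finset.induction with
  | empty => simp
  | insert a s ha ih =>
    have hdeg : (∏ a ∈ s, (Polynomial.C (x a) * Polynomial.X + Polynomial.C (y a))).natDegree
        ≤ s.card :=
      (Polynomial.natDegree_prod_le _ _).trans <|
        (Finset.sum_le_card_nsmul s _ 1 fun i _ => Polynomial.natDegree_linear_le).trans (by simp)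
    rw [Finset.prod_insert ha, Finset.prod_insert ha, Finset.card_insert_of_notMem ha,
      add_comm s.card, resultant_mul_left_of_le Polynomial.natDegree_linear_le hdeg hg, ih,
      resultant_linear_left _ _ hg]

theorem finrank_homogeneousSubmodule_fin_three (n : ℕ) :
    2 * Module.finrank ℂ (homogeneousSubmodule (Fin 3) ℂ n) = (n + 1) * (n + 2) := by
  have hset : {d : Fin 3 →₀ ℕ | d.degree = n} =
      ((Finset.univ : Finset (Fin 3)).finsuppAntidiag n : Set (Fin 3 →₀ ℕ)) := by
    ext d
    simp [Finset.mem_finsuppAntidiag, Finsupp.degree_eq_sum]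
  rw [homogeneousSubmodule_eq_finsupp_supported,
    (AddMonoidAlgebra.supportedEquivFinsupp _).finrank_eq, hset,
    Module.finrank_finsupp_self]
  rw [← Nat.card_eq_fintype_card, Nat.card_coe_set_eq, Set.ncard_coe_finset,
    Finset.card_finsuppAntidiag_nat_eq_choose, Finset.card_univ,
    Fintype.card_fin, show 3 + n - 1 = n + 2 by omega, Nat.choose_symm_add, Nat.choose_two_right]
  rw [Nat.mul_div_cancel' (Nat.even_mul_pred_self _).two_dvd]
  simp [mul_comm]

/-- A basis of `H⁰(ℙ², O(n))` has `k + 1 = (n + 1) (n + 2) / 2` elements. -/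
theorem two_mul_card_basis {n k : ℕ}
    (s : Module.Basis (Fin (k + 1)) ℂ (homogeneousSubmodule (Fin 3) ℂ n)) :
    2 * (k + 1) = (n + 1) * (n + 2) := by
  rw [← finrank_homogeneousSubmodule_fin_three, Module.finrank_eq_card_basis s, Fintype.card_fin]

/-! ### Derivations and triangular changes of rows -/

theorem analyticAt_clm_apply {F : Type*} [NormedAddCommGroup F] [NormedSpace ℂ F]
    {p : Fin 2 → ℂ} {A : (Fin 2 → ℂ) → ((Fin 2 → ℂ) →L[ℂ] F)} {x : (Fin 2 → ℂ) → (Fin 2 → ℂ)}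
    (hA : AnalyticAt ℂ A p) (hx : AnalyticAt ℂ x p) : AnalyticAt ℂ (fun q => A q (x q)) p :=
  ((ContinuousLinearMap.id ℂ ((Fin 2 → ℂ) →L[ℂ] F)).analyticAt_bilinear (A p, x p)).comp₂ hA hx

section Ladder

variable {p : Fin 2 → ℂ} {w : (Fin 2 → ℂ) → (Fin 2 → ℂ)}

theorem analyticAt_act {f : (Fin 2 → ℂ) → ℂ} (hw : AnalyticAt ℂ w p) (hf : AnalyticAt ℂ f p) :
    AnalyticAt ℂ (act w f) p :=
  analyticAt_clm_apply hf.fderiv hw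

theorem analyticAt_act_iterate {f : (Fin 2 → ℂ) → ℂ} (hw : AnalyticAt ℂ w p)
    (hf : AnalyticAt ℂ f p) (a : ℕ) : AnalyticAt ℂ ((act w)^[a] f) p := by
  induction a with
  | zero => exact hf
  | succ a ih => rw [Function.iterate_succ_apply']; exact analyticAt_act hw ih

theorem act_congr {f g : (Fin 2 → ℂ) → ℂ} (h : f =ᶠ[𝓝 p] g) : act w f =ᶠ[𝓝 p] act w g := by
  filter_upwards [h.fderiv (𝕜 := ℂ)] with q hq
  simp only [act, hq]

theorem act_zero : act w 0 = 0 := by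
  funext q
  simp [act]

theorem act_mul {f g : (Fin 2 → ℂ) → ℂ} {q : Fin 2 → ℂ} (hf : AnalyticAt ℂ f q)
    (hg : AnalyticAt ℂ g q) : act w (f * g) q = f q * act w g q + act w f q * g q := by
  simp only [act]
  rw [fderiv_mul hf.differentiableAt hg.differentiableAt]
  simp
  ring

theorem act_sum {ι : Type*} (s : Finset ι) {f : ι → (Fin 2 → ℂ) → ℂ} {q : Fin 2 → ℂ}
    (hf : ∀ i ∈ s, AnalyticAt ℂ (f i) q) : act w (∑ i ∈ s, f i) q = ∑ i ∈ s, act w (f i) q := by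
  simp only [act]
  rw [fderiv_sum fun i hi => (hf i hi).differentiableAt]
  simp

/-- The coefficients expressing the sequence `R 0 = h S`, `R (a + 1) = f a • w (R a) + m a • R a`
through the iterated derivatives `w^c (S)`: the coefficient of `w^c (S)` in `R a`. -/
noncomputable def ladderCoeff (w : (Fin 2 → ℂ) → (Fin 2 → ℂ)) (f m : ℕ → (Fin 2 → ℂ) → ℂ)
    (h : (Fin 2 → ℂ) → ℂ) : ℕ → ℕ → (Fin 2 → ℂ) → ℂ
  | 0, 0 => h
  | 0, _ + 1 => 0
  | a + 1, 0 => f a * act w (ladderCoeff w f m h a 0) + m a * ladderCoeff w f m h a 0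
  | a + 1, c + 1 => f a * act w (ladderCoeff w f m h a (c + 1)) +
      f a * ladderCoeff w f m h a c + m a * ladderCoeff w f m h a (c + 1)

variable {f m : ℕ → (Fin 2 → ℂ) → ℂ} {h : (Fin 2 → ℂ) → ℂ}

theorem ladderCoeff_eq_zero {a c : ℕ} (hac : a < c) : ladderCoeff w f m h a c = 0 := by
  induction a generalizing c with
  | zero => cases c with
    | zero => omega
    | succ c => rfl
  | succ a ih => cases c with
    | zero => omega
    | succ c =>
      rw [ladderCoeff, ih (by omega), ih (by omega), act_zero]
      simp

theorem ladderCoeff_self (a : ℕ) : ladderCoeff w f m h a a = h * ∏ c ∈ Finset.range a, f c := by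
  induction a with
  | zero => simp [ladderCoeff]
  | succ a ih =>
    rw [ladderCoeff, ladderCoeff_eq_zero a.lt_succ_self, act_zero, ih, Finset.prod_range_succ]
    ring

theorem analyticAt_ladderCoeff (hw : AnalyticAt ℂ w p) (hf : ∀ a, AnalyticAt ℂ (f a) p)
    (hm : ∀ a, AnalyticAt ℂ (m a) p) (hh : AnalyticAt ℂ h p) (a c : ℕ) :
    AnalyticAt ℂ (ladderCoeff w f m h a c) p := by
  induction a generalizing c with
  | zero => cases c with
    | zero => exact hh
    | succ c => exact analyticAt_const
  | succ a ih => cases c with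
    | zero =>
      rw [ladderCoeff]
      exact ((hf a).mul (analyticAt_act hw (ih 0))).add ((hm a).mul (ih 0))
    | succ c =>
      rw [ladderCoeff]
      exact (((hf a).mul (analyticAt_act hw (ih (c + 1)))).add ((hf a).mul (ih c))).add
        ((hm a).mul (ih (c + 1)))

/-- The rows `R a` are combinations of the iterated derivatives of `S` along `w`, with the
triangular array of coefficients `ladderCoeff`, which does not depend on `S`. -/
theorem eventuallyEq_sum_ladderCoeff (hw : AnalyticAt ℂ w p) (hf : ∀ a, AnalyticAt ℂ (f a) p)
    (hm : ∀ a, AnalyticAt ℂ (m a) p) (hh : AnalyticAt ℂ h p) {S : (Fin 2 → ℂ) → ℂ}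
    (hS : AnalyticAt ℂ S p) {R : ℕ → (Fin 2 → ℂ) → ℂ} (h0 : R 0 =ᶠ[𝓝 p] h * S)
    (h1 : ∀ a, R (a + 1) =ᶠ[𝓝 p] f a * act w (R a) + m a * R a) (a N : ℕ) (haN : a < N) :
    R a =ᶠ[𝓝 p] ∑ c ∈ Finset.range N, ladderCoeff w f m h a c * (act w)^[c] S := by
  induction a generalizing N with
  | zero =>
    refine h0.trans (Eq.eventuallyEq ?_)
    rw [Finset.sum_eq_single_of_mem 0 (Finset.mem_range.2 haN)]
    · rfl
    · intro c _ hc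
      rw [ladderCoeff_eq_zero (Nat.pos_of_ne_zero hc), zero_mul]
  | succ a ih =>
    obtain ⟨N, rfl⟩ := Nat.exists_eq_add_of_lt (Nat.zero_lt_of_lt haN)
    rw [zero_add] at *
    have hL := analyticAt_ladderCoeff hw hf hm hh
    have hD := analyticAt_act_iterate hw hS
    have hev : ∀ᶠ q in 𝓝 p, ∀ c ∈ Finset.range (N + 1),
        AnalyticAt ℂ (ladderCoeff w f m h a c) q ∧ AnalyticAt ℂ ((act w)^[c] S) q :=
      (Finset.eventually_all _).2 fun c _ =>
        (hL a c).eventually_analyticAt.and (hD c).eventually_analyticAt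
    have ih1 := ih (N + 1) (by omega)
    filter_upwards [h1 a, ih1, act_congr (w := w) ih1, hev] with q hq1 hq2 hq3 hq4
    rw [hq1, Pi.add_apply, Pi.mul_apply, Pi.mul_apply, hq3, hq2]
    have : act w (∑ c ∈ Finset.range (N + 1), ladderCoeff w f m h a c * (act w)^[c] S) q =
        ∑ c ∈ Finset.range (N + 1), (ladderCoeff w f m h a c q * (act w)^[c + 1] S q +
          act w (ladderCoeff w f m h a c) q * (act w)^[c] S q) := by
      rw [act_sum _ fun c hc => (hq4 c hc).1.mul (hq4 c hc).2]
      refine Finset.sum_congr rfl fun c hc => ?_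
      rw [act_mul (hq4 c hc).1 (hq4 c hc).2, Function.iterate_succ_apply']
    rw [this]
    -- The last term of the shifted sum vanishes, so that both sides have the same range.
    have hlast : ladderCoeff w f m h a N = 0 := ladderCoeff_eq_zero (by omega)
    simp only [Finset.sum_apply, Pi.mul_apply]
    rw [Finset.sum_add_distrib, Finset.sum_range_succ (fun c => ladderCoeff w f m h a c q * _),
      hlast, Finset.sum_range_succ' (fun c => act w (ladderCoeff w f m h a c) q * _),
      Finset.sum_range_succ' (fun c => ladderCoeff w f m h a c q * (act w)^[c] S q),
      Finset.sum_range_succ' (fun c => ladderCoeff w f m h (a + 1) c q * _)]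
    simp only [ladderCoeff, Pi.add_apply, Pi.mul_apply, Pi.zero_apply, zero_mul, add_zero,
      add_mul, Finset.sum_add_distrib, mul_add, Finset.mul_sum, mul_assoc]
    ring

/-- A determinant whose rows arise from `h S` by the operators `f a • w + m a` is a multiple of the
determinant of iterated derivatives of `S` along `w`. The terms `m a` do not contribute. -/
theorem det_of_ladder {N : ℕ} (hw : AnalyticAt ℂ w p) (hf : ∀ a, AnalyticAt ℂ (f a) p)
    (hm : ∀ a, AnalyticAt ℂ (m a) p) (hh : AnalyticAt ℂ h p) {S : Fin N → (Fin 2 → ℂ) → ℂ}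
    (hS : ∀ b, AnalyticAt ℂ (S b) p) {R : ℕ → Fin N → (Fin 2 → ℂ) → ℂ}
    (h0 : ∀ b, R 0 b =ᶠ[𝓝 p] h * S b)
    (h1 : ∀ a b, R (a + 1) b =ᶠ[𝓝 p] f a * act w (R a b) + m a * R a b) :
    Matrix.det (Matrix.of fun a b : Fin N => R a b p) =
      h p ^ N * (∏ a : Fin N, ∏ c ∈ Finset.range a, f c p) *
        Matrix.det (Matrix.of fun a b : Fin N => (act w)^[(a : ℕ)] (S b) p) := by
  set L : Matrix (Fin N) (Fin N) ℂ := Matrix.of fun a c => ladderCoeff w f m h a c p with hLdef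
  have hmul : (Matrix.of fun a b : Fin N => R a b p) =
      L * Matrix.of fun a b : Fin N => (act w)^[(a : ℕ)] (S b) p := by
    ext a b
    have := (eventuallyEq_sum_ladderCoeff hw hf hm hh (hS b) (R := fun a => R a b) (h0 b)
      (fun a => h1 a b) a N a.2).self_of_nhds
    simp only [Finset.sum_apply, Pi.mul_apply] at this
    rw [Matrix.of_apply, this, Matrix.mul_apply, Finset.sum_range]
    rfl
  have hL : L.det = ∏ a, L a a := by
    refine Matrix.det_of_isLowerTriangular L fun a c hac => ?_
    simp only [hLdef, Matrix.of_apply]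
    rw [ladderCoeff_eq_zero (Fin.lt_def.1 (OrderDual.toDual_lt_toDual.1 hac)), Pi.zero_apply]
  rw [hmul, Matrix.det_mul, hL]
  congr 1
  simp only [hLdef, Matrix.of_apply, ladderCoeff_self, Pi.mul_apply, Finset.prod_apply]
  rw [Finset.prod_mul_distrib, Finset.prod_const, Finset.card_univ, Fintype.card_fin]

end Ladder

/-! ### The symbol of a web and its Hamiltonian vector field -/

section Characteristic

/-- The chain rule for a polynomial evaluated at a point depending on `y`. -/
theorem hasFDerivAt_eval {σ : Type*} [Fintype σ] (F : MvPolynomial σ ℂ)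
    {x : (Fin 2 → ℂ) → σ → ℂ} {x' : σ → (Fin 2 → ℂ) →L[ℂ] ℂ} {q : Fin 2 → ℂ}
    (hx : ∀ l, HasFDerivAt (fun y => x y l) (x' l) q) :
    HasFDerivAt (fun y => eval (x y) F) (∑ l, eval (x q) (pderiv l F) • x' l) q := by
  classical
  induction F using MvPolynomial.induction_on with
  | C a =>
    simp only [eval_C, pderiv_C, map_zero]
    refine (hasFDerivAt_const (𝕜 := ℂ) a q).congr_fderiv ?_
    ext
    simp
  | add F G hF hG =>
    simp only [map_add]
    refine (hF.add hG).congr_fderiv ?_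
    ext
    simp [add_mul, Finset.sum_add_distrib]
  | mul_X F l hF =>
    simp only [map_mul, eval_X]
    refine (hF.mul (hx l)).congr_fderiv ?_
    ext
    simp [Derivation.leibniz, pderiv_X, Pi.single_apply, add_mul, Finset.sum_add_distrib,
      Finset.mul_sum, mul_assoc, apply_ite, ite_mul]

/-- The polynomial function on the cotangent bundle of a chart defined by a symmetric vector field:
the variables `Sum.inr l` are the coordinates of the base point, `Sum.inl l` those of the
covector. -/
noncomputable def symbol :
    MvPolynomial (Fin 2) (MvPolynomial (Fin 2) ℂ) →+* MvPolynomial (Fin 2 ⊕ Fin 2) ℂ :=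
  eval₂Hom (rename Sum.inr).toRingHom fun l => X (Sum.inl l)

/-- The Hamiltonian vector field of `V`, that is
`∑ l, ∂V/∂ξ_l ∂/∂q_l - ∂V/∂q_l ∂/∂ξ_l`, applied to the polynomial function `F` on the cotangent
bundle. -/
noncomputable def hamiltonian (V F : MvPolynomial (Fin 2 ⊕ Fin 2) ℂ) :
    MvPolynomial (Fin 2 ⊕ Fin 2) ℂ :=
  ∑ l, (pderiv (Sum.inl l) V * pderiv (Sum.inr l) F -
    pderiv (Sum.inr l) V * pderiv (Sum.inl l) F)

/-- The weights for which the base coordinates have degree `0` and the covectors degree `1`. -/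
def fibreWeight : Fin 2 ⊕ Fin 2 → ℕ :=
  Sum.elim 1 0

theorem rename_inr_isWeightedHomogeneous (f : MvPolynomial (Fin 2) ℂ) :
    (rename Sum.inr f : MvPolynomial (Fin 2 ⊕ Fin 2) ℂ).IsWeightedHomogeneous fibreWeight 0 := by
  induction f using MvPolynomial.induction_on with
  | C a => simpa using isWeightedHomogeneous_C _ a
  | add F G hF hG => simpa using hF.add hG
  | mul_X F l hF =>
    simpa [fibreWeight] using hF.mul (isWeightedHomogeneous_X ℂ fibreWeight (Sum.inr l))

theorem symbol_isWeightedHomogeneous {d : ℕ} {u : MvPolynomial (Fin 2) (MvPolynomial (Fin 2) ℂ)}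
    (hu : u.IsHomogeneous d) : (symbol u).IsWeightedHomogeneous fibreWeight d := by
  rw [symbol, coe_eval₂Hom, eval₂_eq]
  refine IsWeightedHomogeneous.sum _ _ _ fun m hm => ?_
  have hmd : ∑ l, m l = d := by
    rw [← hu (mem_support_iff.1 hm), Finsupp.weight_apply, Finsupp.sum_fintype _ _ (by simp)]
    simp
  rw [← zero_add d, ← hmd]
  refine (rename_inr_isWeightedHomogeneous _).mul ?_
  rw [Finset.prod_subset (Finset.subset_univ m.support) (by simp +contextual)]
  refine IsWeightedHomogeneous.prod _ _ _ fun l _ => ?_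
  simpa [fibreWeight] using (isWeightedHomogeneous_X ℂ fibreWeight (Sum.inl l)).pow (m l)

theorem eval_sumElim (F : MvPolynomial (Fin 2 ⊕ Fin 2) ℂ) (x q : Fin 2 → ℂ) :
    eval (Sum.elim x q) F = eval x (aeval (Sum.elim X (C ∘ q)) F : MvPolynomial (Fin 2) ℂ) := by
  induction F using MvPolynomial.induction_on with
  | C a => simp
  | add F G hF hG => simp only [map_add, hF, hG]
  | mul_X F l hF => cases l <;> simp only [map_mul, hF, eval_X, aeval_X] <;> simp

theorem aeval_symbol (u : MvPolynomial (Fin 2) (MvPolynomial (Fin 2) ℂ)) (q : Fin 2 → ℂ) :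
    (aeval (Sum.elim X (C ∘ q)) (symbol u) : MvPolynomial (Fin 2) ℂ) = valueAt u q := by
  have hC (f : MvPolynomial (Fin 2) ℂ) : (aeval (Sum.elim X (C ∘ q))
      (rename Sum.inr f : MvPolynomial (Fin 2 ⊕ Fin 2) ℂ) : MvPolynomial (Fin 2) ℂ) =
        C (eval q f) := by
    induction f using MvPolynomial.induction_on with
    | C a => simp
    | add F G hF hG => simp only [map_add, hF, hG]
    | mul_X F l hF => simp only [map_mul, hF, rename_X, eval_X, aeval_X]; simp
  induction u using MvPolynomial.induction_on with
  | C a => simpa [symbol, valueAt] using hC a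
  | add F G hF hG => simp_all [valueAt]
  | mul_X F l hF => simp_all [valueAt, symbol]

theorem hamiltonian_isWeightedHomogeneous {V F : MvPolynomial (Fin 2 ⊕ Fin 2) ℂ} {d e : ℕ}
    (hV : V.IsWeightedHomogeneous fibreWeight (d + 1))
    (hF : F.IsWeightedHomogeneous fibreWeight (e + 1)) :
    (hamiltonian V F).IsWeightedHomogeneous fibreWeight (d + e + 1) := by
  refine IsWeightedHomogeneous.sum _ _ _ fun l _ => IsWeightedHomogeneous.sub ?_ ?_
  · exact (hV.pderiv (n' := d) rfl).mul (hF.pderiv (n' := e + 1) rfl)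
  · rw [show d + e + 1 = d + 1 + e by ring]
    exact (hV.pderiv (n' := d + 1) rfl).mul (hF.pderiv (n' := e) rfl)

/-- Euler's identity in the covector variables. -/
theorem euler_fibre {F : MvPolynomial (Fin 2 ⊕ Fin 2) ℂ} {e : ℕ}
    (hF : F.IsWeightedHomogeneous fibreWeight e) (x q : Fin 2 → ℂ) :
    ∑ l, x l * eval (Sum.elim x q) (pderiv (Sum.inl l) F) = e * eval (Sum.elim x q) F := by
  have := congrArg (eval (Sum.elim x q)) hF.sum_weight_X_mul_pderiv
  simpa [fibreWeight] using this

/-- The covector annihilating the vector `z`, for the area form. -/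
def annihilator (z : Fin 2 → ℂ) : Fin 2 → ℂ :=
  ![z 1, -z 0]

/-- The product of the values of the factors `z b`, `b ≠ a`, of a product of vectors on the covector
annihilating the factor `z a`. -/
def cofactor {d : ℕ} (z : Fin d → Fin 2 → ℂ) (a : Fin d) : ℂ :=
  ∏ b ∈ Finset.univ.erase a, (z b 0 * z a 1 - z b 1 * z a 0)

/-- The symbol of a product of vectors vanishes on the covectors annihilating one of the factors. -/
theorem eval_annihilator_symbol {d : ℕ} {u : MvPolynomial (Fin 2) (MvPolynomial (Fin 2) ℂ)}
    {q : Fin 2 → ℂ} {z : Fin d → Fin 2 → ℂ}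
    (hz : ∏ a, (∑ l, C (z a l) * X l) = valueAt u q) (a : Fin d) :
    eval (Sum.elim (annihilator (z a)) q) (symbol u) = 0 := by
  rw [eval_sumElim, aeval_symbol, ← hz, map_prod]
  refine Finset.prod_eq_zero (Finset.mem_univ a) ?_
  simp [annihilator]
  ring

/-- Over a covector annihilating the factor `z a`, the Hamiltonian vector field of the symbol lies
over a multiple of `z a`. -/
theorem eval_annihilator_pderiv_symbol {d : ℕ}
    {u : MvPolynomial (Fin 2) (MvPolynomial (Fin 2) ℂ)}
    {q : Fin 2 → ℂ} {z : Fin d → Fin 2 → ℂ}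
    (hz : ∏ a, (∑ l, C (z a l) * X l) = valueAt u q) (a : Fin d) (l : Fin 2) :
    eval (Sum.elim (annihilator (z a)) q) (pderiv (Sum.inl l) (symbol u)) =
      cofactor z a * z a l := by
  rw [eval_sumElim, aeval_sumElim_pderiv_inl, aeval_symbol, ← hz,
    ← Finset.mul_prod_erase _ _ (Finset.mem_univ a), Derivation.leibniz]
  have h0 : eval (annihilator (z a)) (∑ l, C (z a l) * X l) = 0 := by
    simp [annihilator]
    ring
  rw [map_add, smul_eq_mul, smul_eq_mul, map_mul, h0, zero_mul, zero_add, map_mul, map_prod,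
    cofactor]
  congr 1
  · refine Finset.prod_congr rfl fun b _ => ?_
    simp [annihilator]
    ring
  · fin_cases l <;> simp [pderiv_X]

/-- The Hamiltonian vector field of the symbol along the covectors annihilating the factor `w a`: it
is the lift of `cofactor • w a`, corrected by a multiple of the Euler field of the fibre, on which
homogeneous functions act by a scalar. -/
theorem eval_hamiltonian {d e : ℕ} {u : MvPolynomial (Fin 2) (MvPolynomial (Fin 2) ℂ)}
    {q : Fin 2 → ℂ} {w : Fin d → (Fin 2 → ℂ) → (Fin 2 → ℂ)}
    (hw : ∀ b, AnalyticAt ℂ (w b) q)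
    (hprod : ∀ᶠ y in 𝓝 q, ∏ b, (∑ l, C (w b y l) * X l) = valueAt u y) (a : Fin d)
    {F : MvPolynomial (Fin 2 ⊕ Fin 2) ℂ} (hF : F.IsWeightedHomogeneous fibreWeight e) :
    eval (Sum.elim (annihilator (w a q)) q) (hamiltonian (symbol u) F) =
      cofactor (fun b => w b q) a *
          act (w a) (fun y => eval (Sum.elim (annihilator (w a y)) y) F) q +
        -(e * cofactor (fun b => w b q) a * ∑ l, fderiv ℂ (w a) q (Pi.single l 1) l) *
          eval (Sum.elim (annihilator (w a q)) q) F := by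
  have hD (l : Fin 2) : HasFDerivAt (fun y => w a y l)
      ((ContinuousLinearMap.proj l).comp (fderiv ℂ (w a) q)) q :=
    (ContinuousLinearMap.proj (R := ℂ) (φ := fun _ : Fin 2 => ℂ) l).hasFDerivAt.comp q
      (hw a).differentiableAt.hasFDerivAt
  set D := fderiv ℂ (w a) q with hDdef
  let x' : Fin 2 ⊕ Fin 2 → (Fin 2 → ℂ) →L[ℂ] ℂ := Sum.elim
    ![(ContinuousLinearMap.proj 1).comp D, -(ContinuousLinearMap.proj 0).comp D]
    fun l => ContinuousLinearMap.proj l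
  have hx (l) : HasFDerivAt (fun y => Sum.elim (annihilator (w a y)) y l) (x' l) q := by
    rcases l with l | l
    · fin_cases l
      · exact hD 1
      · exact (hD 0).neg
    · exact (ContinuousLinearMap.proj (R := ℂ) (φ := fun _ : Fin 2 => ℂ) l).hasFDerivAt
  have hdir (z : Fin 2 → ℂ) (l : Fin 2) :
      D z l = z 0 * D (Pi.single 0 1) l + z 1 * D (Pi.single 1 1) l := by
    have : z = z 0 • Pi.single 0 1 + z 1 • Pi.single 1 1 := by
      funext i
      fin_cases i <;> simp
    conv_lhs => rw [this]
    simp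
  -- The symbol vanishes identically along the annihilators of `w a`, so does its differential.
  have hV : ∀ z, (∑ l, eval (Sum.elim (annihilator (w a q)) q) (pderiv l (symbol u)) • x' l) z
      = 0 := by
    have h0 : (fun y => eval (Sum.elim (annihilator (w a y)) y) (symbol u)) =ᶠ[𝓝 q]
        fun _ => (0 : ℂ) := by
      filter_upwards [hprod] with y hy
      exact eval_annihilator_symbol hy a
    intro z
    rw [(hasFDerivAt_eval (symbol u) hx).unique
      ((hasFDerivAt_const (0 : ℂ) q).congr_of_eventuallyEq h0)]
    rfl
  have h1 := hV (Pi.single 0 1)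
  have h2 := hV (Pi.single 1 1)
  have hpr := eval_annihilator_pderiv_symbol hprod.self_of_nhds a
  have heu := euler_fibre hF (annihilator (w a q)) q
  rw [act, (hasFDerivAt_eval F hx).fderiv, hamiltonian]
  simp only [Fintype.sum_sum_type, Fin.sum_univ_two, map_add, map_sub, map_mul, x',
    _root_.add_apply, _root_.smul_apply, Sum.elim_inl, Sum.elim_inr,
    Matrix.cons_val_zero, Matrix.cons_val_one, ContinuousLinearMap.comp_apply,
    _root_.neg_apply, ContinuousLinearMap.proj_apply, smul_eq_mul, annihilator,
    Pi.single_eq_same, ne_eq, one_ne_zero, zero_ne_one, not_false_eq_true, Pi.single_eq_of_ne,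
    mul_zero, mul_one, add_zero, zero_add] at h1 h2 heu hpr ⊢
  rw [hdir (w a q) 0, hdir (w a q) 1]
  simp only [hpr] at h1 h2 ⊢
  linear_combination -(eval (Sum.elim ![w a q 1, -w a q 0] q) (pderiv (Sum.inl 0) F)) * h1 -
    (eval (Sum.elim ![w a q 1, -w a q 0] q) (pderiv (Sum.inl 1) F)) * h2 -
    cofactor (fun b => w b q) a * (D (Pi.single 0 1) 0 + D (Pi.single 1 1) 1) * heu

end Characteristic

/-! ### The extactic section as a polynomial on each chart -/

section Characteristic

/-- The entry in row `a` of the determinant on the cotangent bundle that computes `σ_W`: the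
function `f`, its derivative along the vector annihilated by the covector, and then the iterated derivatives
of the latter along the Hamiltonian vector field of `V`. -/
noncomputable def charRow (V : MvPolynomial (Fin 2 ⊕ Fin 2) ℂ) (f : MvPolynomial (Fin 2) ℂ) :
    ℕ → MvPolynomial (Fin 2 ⊕ Fin 2) ℂ
  | 0 => rename Sum.inr f
  | 1 => X (Sum.inl 0) * rename Sum.inr (pderiv 1 f) - X (Sum.inl 1) * rename Sum.inr (pderiv 0 f)
  | a + 2 => hamiltonian V (charRow V f (a + 1))

/-- The degree in the covector of `charRow V f a`, if `V` has degree `d`. -/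
def charRowDegree (d : ℕ) : ℕ → ℕ
  | 0 => 0
  | a + 1 => a * (d - 1) + 1

theorem charRow_isWeightedHomogeneous {d : ℕ} (hd : 1 ≤ d) {V : MvPolynomial (Fin 2 ⊕ Fin 2) ℂ}
    (hV : V.IsWeightedHomogeneous fibreWeight d) (f : MvPolynomial (Fin 2) ℂ) (a : ℕ) :
    (charRow V f a).IsWeightedHomogeneous fibreWeight (charRowDegree d a) := by
  obtain ⟨d, rfl⟩ := Nat.exists_eq_add_of_le' hd
  match a with
  | 0 => exact rename_inr_isWeightedHomogeneous f
  | a + 1 =>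
    rw [charRowDegree, Nat.add_sub_cancel]
    induction a with
    | zero =>
      rw [zero_mul, zero_add]
      exact ((isWeightedHomogeneous_X ℂ fibreWeight (Sum.inl 0)).mul
        (rename_inr_isWeightedHomogeneous _)).sub
        ((isWeightedHomogeneous_X ℂ fibreWeight (Sum.inl 1)).mul
        (rename_inr_isWeightedHomogeneous _))
    | succ a ih =>
      rw [charRow, show (a + 1) * d + 1 = d + a * d + 1 by ring]
      exact hamiltonian_isWeightedHomogeneous hV ih

theorem charDet_isWeightedHomogeneous {d N : ℕ} (hd : 1 ≤ d)
    {V : MvPolynomial (Fin 2 ⊕ Fin 2) ℂ}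
    (hV : V.IsWeightedHomogeneous fibreWeight d) (f : Fin N → MvPolynomial (Fin 2) ℂ) :
    (Matrix.det (Matrix.of fun a b : Fin N => charRow V (f b) a)).IsWeightedHomogeneous fibreWeight
      (∑ a : Fin N, charRowDegree d a) := by
  rw [← Matrix.det_transpose, Matrix.det_apply]
  refine IsWeightedHomogeneous.sum _ _ _ fun τ _ => ?_
  rw [Units.smul_def, zsmul_eq_mul]
  have : ((Equiv.Perm.sign τ : ℤ) : MvPolynomial (Fin 2 ⊕ Fin 2) ℂ) =
      C ((Equiv.Perm.sign τ : ℤ) : ℂ) := by simp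
  rw [this]
  refine IsWeightedHomogeneous.C_mul ?_ _
  exact IsWeightedHomogeneous.prod _ _ _ fun a _ => charRow_isWeightedHomogeneous hd hV _ _

theorem act_eval (w : (Fin 2 → ℂ) → (Fin 2 → ℂ)) (f : MvPolynomial (Fin 2) ℂ) (q : Fin 2 → ℂ) :
    act w (fun y => eval y f) q =
      eval q (pderiv 0 f) * w q 0 + eval q (pderiv 1 f) * w q 1 := by
  rw [act, (hasFDerivAt_eval f (x := fun y => y) (x' := fun l => ContinuousLinearMap.proj l)
    fun l => (ContinuousLinearMap.proj (R := ℂ) (φ := fun _ : Fin 2 => ℂ) l).hasFDerivAt).fderiv]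
  simp

theorem prod_prod_range_ite (k : ℕ) (t : ℂ) :
    ∏ a : Fin (k + 1), ∏ c ∈ Finset.range a, (if c = 0 then 1 else t) = t ^ (k * (k - 1) / 2) := by
  have h (a : ℕ) : ∏ c ∈ Finset.range a, (if c = 0 then 1 else t) = t ^ (a - 1) := by
    cases a with
    | zero => simp
    | succ a => rw [Finset.prod_range_succ']; simp
  rw [Fin.prod_univ_eq_prod_range (fun a => ∏ c ∈ Finset.range a, (if c = 0 then 1 else t)) (k + 1)]
  simp only [h]
  rw [Finset.prod_pow_eq_pow_sum, Finset.sum_range_succ']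
  simp [Finset.sum_range_id]

/-- On the covectors annihilating a factor `w a` of the web, the determinant of the `charRow`s is
`σ_W(w a)` multiplied by the power `k (k - 1) / 2` of the cofactor. -/
theorem eval_charDet {d k : ℕ} {u : MvPolynomial (Fin 2) (MvPolynomial (Fin 2) ℂ)} (hd : 1 ≤ d)
    (hu : u.IsHomogeneous d)
    {p : Fin 2 → ℂ} {w : Fin d → (Fin 2 → ℂ) → (Fin 2 → ℂ)}
    (hw : ∀ b, AnalyticAt ℂ (w b) p)
    (hprod : ∀ᶠ y in 𝓝 p, ∏ b, (∑ l, C (w b y l) * X l) = valueAt u y) (a : Fin d)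
    (f : Fin (k + 1) → MvPolynomial (Fin 2) ℂ) :
    eval (Sum.elim (annihilator (w a p)) p)
        (Matrix.det (Matrix.of fun c b : Fin (k + 1) => charRow (symbol u) (f b) c)) =
      cofactor (fun b => w b p) a ^ (k * (k - 1) / 2) *
        Matrix.det (Matrix.of fun c b : Fin (k + 1) =>
          (act (w a))^[(c : ℕ)] (fun y => eval y (f b)) p) := by
  have hcomp (b : Fin d) (l : Fin 2) : AnalyticAt ℂ (fun y => w b y l) p :=
    analyticAt_pi_iff.1 (hw b) l
  have hcof : AnalyticAt ℂ (fun y => cofactor (fun b => w b y) a) p := by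
    unfold cofactor
    exact Finset.analyticAt_fun_prod _ fun b _ =>
      ((hcomp b 0).mul (hcomp a 1)).sub ((hcomp b 1).mul (hcomp a 0))
  have hdiv : AnalyticAt ℂ (fun y => ∑ l, fderiv ℂ (w a) y (Pi.single l 1) l) p :=
    Finset.analyticAt_fun_sum _ fun l _ =>
      analyticAt_pi_iff.1 (analyticAt_clm_apply (hw a).fderiv analyticAt_const) l
  -- The derivative producing row `1` is exactly `w a`; only the later ones carry the cofactor.
  let h : ℕ → (Fin 2 → ℂ) → ℂ := fun c y => if c = 0 then 1 else cofactor (fun b => w b y) a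
  let m : ℕ → (Fin 2 → ℂ) → ℂ := fun c y => if c = 0 then 0 else
    -(charRowDegree d c * cofactor (fun b => w b y) a *
      ∑ l, fderiv ℂ (w a) y (Pi.single l 1) l)
  have hh (c) : AnalyticAt ℂ (h c) p := by
    by_cases hc : c = 0
    · simp only [h, if_pos hc]; exact analyticAt_const
    · simp only [h, if_neg hc]; exact hcof
  have hm (c) : AnalyticAt ℂ (m c) p := by
    by_cases hc : c = 0
    · simp only [m, if_pos hc]; exact analyticAt_const
    · simp only [m, if_neg hc]; exact ((analyticAt_const.mul hcof).mul hdiv).neg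
  have key := det_of_ladder (hw a) hh hm (analyticAt_const (v := (1 : ℂ)))
    (S := fun b : Fin (k + 1) => fun y => eval y (f b))
    (fun b => AnalyticOnNhd.eval_mvPolynomial (f b) p (Set.mem_univ p))
    (R := fun c b y => eval (Sum.elim (annihilator (w a y)) y) (charRow (symbol u) (f b) c))
    (fun b => by
      refine Eventually.of_forall fun y => ?_
      simp [charRow, eval_rename, Function.comp_def])
    (fun c b => by
      filter_upwards [(eventually_all.2 fun b => (hw b).eventually_analyticAt),
        hprod.eventually_nhds] with y hy1 hy2
      match c with
      | 0 =>
        have : (fun y => eval (Sum.elim (annihilator (w a y)) y) (charRow (symbol u) (f b) 0)) =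
            fun y => eval y (f b) := by
          funext y
          simp [charRow, eval_rename, Function.comp_def]
        simp only [Pi.add_apply, Pi.mul_apply, this, act_eval]
        simp [charRow, eval_rename, Function.comp_def, h, m, annihilator]
        ring
      | c + 1 =>
        rw [charRow, eval_hamiltonian hy1 hy2 a
          (charRow_isWeightedHomogeneous hd (symbol_isWeightedHomogeneous hu) (f b) (c + 1))]
        simp [h, m])
  rw [RingHom.map_det]
  refine Eq.trans ?_ (key.trans ?_)
  · rfl
  · rw [one_pow, one_mul]
    congr 1
    exact prod_prod_range_ite k _

end Characteristic

section BinaryForm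

/-- The dehomogenization `ξ = (T, -1)` of a polynomial function on the cotangent bundle. With this
sign the root of the symbol belonging to the factor `w a` is the covector `annihilator (w a)`, up to
scaling. -/
noncomputable def fibrePoly :
    MvPolynomial (Fin 2 ⊕ Fin 2) ℂ →ₐ[ℂ] Polynomial (MvPolynomial (Fin 2) ℂ) :=
  aeval (Sum.elim ![Polynomial.X, -1] fun l => Polynomial.C (X l))

/-- The binary form of degree `M` in the covector is recovered from its dehomogenization. -/
theorem fibrePoly_spec {G : MvPolynomial (Fin 2 ⊕ Fin 2) ℂ} {M : ℕ}
    (hG : G.IsWeightedHomogeneous fibreWeight M) :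
    (fibrePoly G).natDegree ≤ M ∧ ∀ x y q, ∑ l ∈ Finset.range (M + 1),
      ((fibrePoly G).map (eval q)).coeff l * x ^ l * y ^ (M - l) =
        eval (Sum.elim ![x, -y] q) G := by
  induction hG using IsWeightedHomogeneous.induction_on with
  | zero => simp
  | add F G hF hG ihF ihG =>
    refine ⟨?_, fun x y q => ?_⟩
    · rw [map_add]
      exact (Polynomial.natDegree_add_le _ _).trans (max_le ihF.1 ihG.1)
    · rw [map_add, map_add, ← ihF.2, ← ihG.2, ← Finset.sum_add_distrib]
      exact Finset.sum_congr rfl fun l _ => by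
        rw [Polynomial.map_add, Polynomial.coeff_add]
        ring
  | monomial m c hm =>
    have hmM : m (Sum.inl 0) + m (Sum.inl 1) = M := by
      rw [← hm, Finsupp.weight_apply, Finsupp.sum_fintype _ _ (by simp)]
      simp [fibreWeight]
    have hmon : fibrePoly (monomial m c) = Polynomial.monomial (m (Sum.inl 0))
        (C (c * (-1) ^ m (Sum.inl 1)) * X 0 ^ m (Sum.inr 0) * X 1 ^ m (Sum.inr 1)) := by
      rw [fibrePoly, aeval_monomial, Finsupp.prod_fintype _ _ (by simp),
        ← Polynomial.C_mul_X_pow_eq_monomial]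
      rw [show algebraMap ℂ (Polynomial (MvPolynomial (Fin 2) ℂ)) c = Polynomial.C (C c) from rfl]
      simp
      ring
    rw [hmon]
    refine ⟨(Polynomial.natDegree_monomial_le _).trans (by omega), fun x y q => ?_⟩
    rw [Finset.sum_eq_single_of_mem (m (Sum.inl 0)) (Finset.mem_range.2 (by omega))]
    · rw [Polynomial.map_monomial, Polynomial.coeff_monomial, if_pos rfl, eval_monomial,
        Finsupp.prod_fintype _ _ (by simp), ← hmM, Nat.add_sub_cancel_left]
      simp [neg_pow y]
      ring
    · intro l _ hl
      rw [Polynomial.map_monomial, Polynomial.coeff_monomial, if_neg hl.symm]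
      ring

theorem map_fibrePoly (F : MvPolynomial (Fin 2 ⊕ Fin 2) ℂ) (q : Fin 2 → ℂ) :
    (fibrePoly F).map (eval q) =
      aeval ![Polynomial.X, -1] (aeval (Sum.elim X (C ∘ q)) F : MvPolynomial (Fin 2) ℂ) := by
  induction F using MvPolynomial.induction_on with
  | C a => simp [fibrePoly]
  | add F G hF hG => simp only [map_add, Polynomial.map_add, hF, hG]
  | mul_X F l hF =>
    rw [map_mul, Polynomial.map_mul, hF, map_mul, map_mul]
    congr 1
    rcases l with l | l
    · fin_cases l <;> simp [fibrePoly]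
    · simp [fibrePoly]

/-- The resultant of the symbol with `G` is the product of the values of `G` on the covectors
annihilating the factors of the web, although these covectors are not rational functions. -/
theorem eval_resultant_fibrePoly {d M : ℕ} {u : MvPolynomial (Fin 2) (MvPolynomial (Fin 2) ℂ)}
    {q : Fin 2 → ℂ} {z : Fin d → Fin 2 → ℂ}
    (hz : ∏ a, (∑ l, C (z a l) * X l) = valueAt u q)
    {G : MvPolynomial (Fin 2 ⊕ Fin 2) ℂ} (hG : G.IsWeightedHomogeneous fibreWeight M) :
    eval q (Polynomial.resultant (fibrePoly (symbol u)) (fibrePoly G) d M) =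
      ∏ a, eval (Sum.elim (annihilator (z a)) q) G := by
  have hV : (fibrePoly (symbol u)).map (eval q) =
      ∏ a, (Polynomial.C (z a 0) * Polynomial.X + Polynomial.C (-z a 1)) := by
    rw [map_fibrePoly, aeval_symbol, ← hz, map_prod]
    refine Finset.prod_congr rfl fun a _ => ?_
    simp
  have := resultant_prod_linear_left Finset.univ (fun a => z a 0) (fun a => -z a 1)
    (Polynomial.natDegree_map_le.trans (fibrePoly_spec hG).1 :
      ((fibrePoly G).map (eval q)).natDegree ≤ M)
  rw [Finset.card_univ, Fintype.card_fin, ← hV, Polynomial.resultant_map_map] at this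
  rw [this]
  refine Finset.prod_congr rfl fun a _ => ?_
  rw [neg_neg, (fibrePoly_spec hG).2]
  rfl

end BinaryForm

/-- The product of the cofactors is the discriminant up to the sign `(-1) ^ (d (d - 1) / 2)`. -/
theorem prod_cofactor {d : ℕ} (w : Fin d → (Fin 2 → ℂ) → (Fin 2 → ℂ)) (p : Fin 2 → ℂ) :
    ∏ a, cofactor (fun b => w b p) a = (-1) ^ (∑ a : Fin d, (Finset.Ioi a).card) * disc w p := by
  simp only [cofactor]
  have h := Finset.prod_prod_Ioi_mul_eq_prod_prod_off_diag
    fun b a : Fin d => (w b p 0 * w a p 1 - w b p 1 * w a p 0)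
  simp only [Finset.compl_singleton] at h
  rw [← h, disc, ← Finset.prod_pow_eq_pow_sum, ← Finset.prod_mul_distrib]
  refine Finset.prod_congr rfl fun a _ => ?_
  rw [← Finset.prod_const, ← Finset.prod_mul_distrib]
  refine Finset.prod_congr rfl fun b _ => ?_
  ring

theorem eval_dehomogenize (i : Fin 3) (F : MvPolynomial (Fin 3) ℂ) (q : Fin 2 → ℂ) :
    eval q (dehomogenize i F) = eval (chartPt i q) F := by
  induction F using MvPolynomial.induction_on with
  | C a => simp [dehomogenize]
  | add F G hF hG => simp only [map_add, hF, hG]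
  | mul_X F l hF =>
    rw [map_mul, map_mul, hF, map_mul]
    congr 1
    refine Fin.succAboveCases i ?_ (fun l => ?_) l <;> simp [dehomogenize, chartPt]

/-- On every chart the extactic section is given by one polynomial, for all decompositions of the
web, whether or not the discriminant vanishes. -/
theorem exists_eval_eq_extacticValue {d n k : ℕ} {e : ℤ} (hd : 1 ≤ d) (v : SymSection d e)
    (s : Module.Basis (Fin (k + 1)) ℂ (homogeneousSubmodule (Fin 3) ℂ n)) (i : Fin 3) :
    ∃ g : MvPolynomial (Fin 2) ℂ, ∀ p w, IsDecomposition v i p w →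
      eval p g = extacticValue s i w p := by
  set f : Fin (k + 1) → MvPolynomial (Fin 2) ℂ := fun b =>
    dehomogenize i (s b : MvPolynomial (Fin 3) ℂ) with hf
  set G := Matrix.det (Matrix.of fun c b : Fin (k + 1) => charRow (symbol (v.loc i)) (f b) c)
    with hGdef
  have hG := charDet_isWeightedHomogeneous hd
    (symbol_isWeightedHomogeneous (v.homogeneous i)) f
  set ε : ℂ := (-1) ^ (∑ a : Fin d, (Finset.Ioi a).card) with hε
  have hεε : ε * ε = 1 := by
    rw [hε, ← mul_pow]
    simp
  refine ⟨C (ε ^ (k * (k - 1) / 2)) * Polynomial.resultant (fibrePoly (symbol (v.loc i)))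
    (fibrePoly G) d (∑ a : Fin (k + 1), charRowDegree d a), fun p w hw => ?_⟩
  have hsig (a : Fin d) : Matrix.det (Matrix.of fun c b : Fin (k + 1) =>
          (act (w a))^[(c : ℕ)] (fun y => eval y (f b)) p) = sigma s i (w a) p := by
    rw [sigma]
    simp only [hf, eval_dehomogenize]
    rfl
  rw [map_mul, eval_C, eval_resultant_fibrePoly hw.prod_eq.self_of_nhds hG]
  simp only [eval_charDet hd (v.homogeneous i) hw.analytic hw.prod_eq, hsig]
  rw [Finset.prod_mul_distrib, Finset.prod_pow, prod_cofactor, mul_pow, ← mul_assoc, ← mul_assoc,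
    ← mul_pow, hεε, one_pow, one_mul, extacticValue]

/-! ### Changes of charts -/

section Transition

variable {i j : Fin 3} {p : Fin 2 → ℂ}

theorem chartPt_self (i : Fin 3) (p : Fin 2 → ℂ) : chartPt i p i = 1 := by
  simp [chartPt]

theorem chartPt_succAbove (i : Fin 3) (p : Fin 2 → ℂ) (l : Fin 2) :
    chartPt i p (i.succAbove l) = p l := by
  simp [chartPt]

theorem chartPt_transition (hc : chartPt i p j ≠ 0) (l : Fin 3) :
    chartPt j (transition i j p) l = chartPt i p l / chartPt i p j := by
  refine Fin.succAboveCases j ?_ (fun l => ?_) l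
  · rw [chartPt_self, div_self hc]
  · rw [chartPt_succAbove, transition]

theorem chartPt_transition_ne_zero (hc : chartPt i p j ≠ 0) :
    chartPt j (transition i j p) i ≠ 0 := by
  rw [chartPt_transition hc, chartPt_self]
  exact one_div_ne_zero hc

theorem transition_transition (hc : chartPt i p j ≠ 0) :
    transition j i (transition i j p) = p := by
  funext l
  rw [transition, chartPt_transition hc, chartPt_transition hc, chartPt_self, chartPt_succAbove]
  field_simp

/-- The differential of the homogeneous coordinate `X_x` on the chart `U_i`. -/
noncomputable def chartDeriv (i x : Fin 3) : (Fin 2 → ℂ) →L[ℂ] ℂ :=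
  i.insertNth (α := fun _ => (Fin 2 → ℂ) →L[ℂ] ℂ) 0 (fun l => ContinuousLinearMap.proj l) x

theorem hasFDerivAt_chartPt (i x : Fin 3) (p : Fin 2 → ℂ) :
    HasFDerivAt (fun y => chartPt i y x) (chartDeriv i x) p := by
  refine Fin.succAboveCases i ?_ (fun l => ?_) x
  · simpa [chartPt, chartDeriv] using! hasFDerivAt_const (𝕜 := ℂ) (1 : ℂ) p
  · simpa [chartPt, chartDeriv] using!
      (ContinuousLinearMap.proj (R := ℂ) (φ := fun _ : Fin 2 => ℂ) l).hasFDerivAt (x := p)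

theorem analyticAt_chartPt (i x : Fin 3) (p : Fin 2 → ℂ) :
    AnalyticAt ℂ (fun y => chartPt i y x) p := by
  refine Fin.succAboveCases i ?_ (fun l => ?_) x
  · simpa [chartPt] using analyticAt_const
  · simpa [chartPt] using!
      (ContinuousLinearMap.proj (R := ℂ) (φ := fun _ : Fin 2 => ℂ) l).analyticAt p

theorem eventually_chartPt_ne_zero (hc : chartPt i p j ≠ 0) : ∀ᶠ y in 𝓝 p, chartPt i y j ≠ 0 :=
  (analyticAt_chartPt i j p).continuousAt.eventually_ne hc

theorem analyticAt_transition (hc : chartPt i p j ≠ 0) : AnalyticAt ℂ (transition i j) p :=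
  AnalyticAt.pi fun l =>
    (analyticAt_chartPt i (j.succAbove l) p).div (analyticAt_chartPt i j p) hc

theorem fderiv_transition_apply (hc : chartPt i p j ≠ 0) (z : Fin 2 → ℂ) (l : Fin 2) :
    fderiv ℂ (transition i j) p z l =
      (chartDeriv i (j.succAbove l) z * chartPt i p j -
        chartPt i p (j.succAbove l) * chartDeriv i j z) / chartPt i p j ^ 2 := by
  have h1 : HasFDerivAt (fun y => transition i j y l)
      ((ContinuousLinearMap.proj l).comp (fderiv ℂ (transition i j) p)) p :=
    (ContinuousLinearMap.proj (R := ℂ) (φ := fun _ : Fin 2 => ℂ) l).hasFDerivAt.comp p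
      (analyticAt_transition hc).differentiableAt.hasFDerivAt
  have h2 : HasFDerivAt ((fun y => transition i j y l) * fun y => chartPt i y j)
      (chartDeriv i (j.succAbove l)) p := by
    -- Differentiate `transition · X_j = X_{j.succAbove l}` instead of the quotient.
    refine (hasFDerivAt_chartPt i (j.succAbove l) p).congr_of_eventuallyEq ?_
    filter_upwards [eventually_chartPt_ne_zero hc] with y hy
    simp only [Pi.mul_apply, transition]
    field_simp
  have := congrArg (fun L => L z) ((h1.mul (hasFDerivAt_chartPt i j p)).unique h2)
  simp [transition] at this
  rw [← this]
  field_simp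
  ring

/-- The Jacobian determinant of a change of charts is `± X_j ^ (-3)`, so that its square does not
depend on the sign. -/
theorem wedge_fderiv_transition (hc : chartPt i p j ≠ 0) (y z : Fin 2 → ℂ) :
    (fderiv ℂ (transition i j) p y 0 * fderiv ℂ (transition i j) p z 1 -
        fderiv ℂ (transition i j) p y 1 * fderiv ℂ (transition i j) p z 0) ^ 2 =
      (chartPt i p j ^ (-3 : ℤ)) ^ 2 * (y 0 * z 1 - y 1 * z 0) ^ 2 := by
  simp only [fderiv_transition_apply hc]
  rw [zpow_neg]
  fin_cases i <;> fin_cases j <;>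
    simp [chartDeriv, chartPt, Fin.insertNth, Fin.succAboveCases, Fin.succAbove] at hc ⊢ <;>
    field_simp <;> ring

end Transition

/-! ### Transport of decompositions between charts -/

section Transport

variable {i j : Fin 3} {p : Fin 2 → ℂ}

theorem eval_smul_of_isHomogeneous {σ : Type*} [Fintype σ] {F : MvPolynomial σ ℂ} {n : ℕ}
    (hF : F.IsHomogeneous n) (c : ℂ) (x : σ → ℂ) : eval (c • x) F = c ^ n * eval x F := by
  rw [eval_eq', eval_eq', Finset.mul_sum]
  refine Finset.sum_congr rfl fun m hm => ?_
  have hmn : ∑ l, m l = n := by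
    rw [← hF (mem_support_iff.1 hm), Finsupp.weight_apply, Finsupp.sum_fintype _ _ (by simp)]
    simp
  simp only [Pi.smul_apply, smul_eq_mul, mul_pow]
  rw [Finset.prod_mul_distrib, Finset.prod_pow_eq_pow_sum, hmn]
  ring

theorem eval_chartPt_eq {F : MvPolynomial (Fin 3) ℂ} {n : ℕ} (hF : F.IsHomogeneous n)
    (hc : chartPt i p j ≠ 0) :
    eval (chartPt i p) F = chartPt i p j ^ n * eval (chartPt j (transition i j p)) F := by
  rw [← eval_smul_of_isHomogeneous hF]
  congr 2
  funext l
  rw [Pi.smul_apply, chartPt_transition hc, smul_eq_mul, mul_div_cancel₀ _ hc]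

/-- The push-forward to the chart `U_j` of the vector field `w` on the chart `U_i`, multiplied by
the function `h`. -/
noncomputable def pushField (i j : Fin 3) (h : (Fin 2 → ℂ) → ℂ)
    (w : (Fin 2 → ℂ) → (Fin 2 → ℂ)) : (Fin 2 → ℂ) → (Fin 2 → ℂ) :=
  fun y => h (transition j i y) •
    fderiv ℂ (transition i j) (transition j i y) (w (transition j i y))

theorem pushField_transition (h : (Fin 2 → ℂ) → ℂ) (w : (Fin 2 → ℂ) → (Fin 2 → ℂ))
    (hc : chartPt i p j ≠ 0) :
    pushField i j h w (transition i j p) = h p • fderiv ℂ (transition i j) p (w p) := by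
  rw [pushField, transition_transition hc]

theorem analyticAt_pushField {h : (Fin 2 → ℂ) → ℂ} {w : (Fin 2 → ℂ) → (Fin 2 → ℂ)}
    (hh : AnalyticAt ℂ h p) (hw : AnalyticAt ℂ w p) (hc : chartPt i p j ≠ 0) :
    AnalyticAt ℂ (pushField i j h w) (transition i j p) := by
  have ht := analyticAt_transition (chartPt_transition_ne_zero hc)
  have hp := transition_transition hc
  refine AnalyticAt.fun_comp (g := fun q => h q • fderiv ℂ (transition i j) q (w q))
    (f := transition j i) ?_ ht
  rw [hp]
  exact hh.smul (analyticAt_clm_apply (analyticAt_transition hc).fderiv hw)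

theorem act_pushField {h : (Fin 2 → ℂ) → ℂ} {w : (Fin 2 → ℂ) → (Fin 2 → ℂ)}
    {g : (Fin 2 → ℂ) → ℂ} (hg : DifferentiableAt ℂ g (transition i j p))
    (hc : chartPt i p j ≠ 0) :
    act (pushField i j h w) g (transition i j p) =
      h p * act w (fun y => g (transition i j y)) p := by
  have h1 := hg.hasFDerivAt.comp p (analyticAt_transition hc).differentiableAt.hasFDerivAt
  rw [act, act, pushField_transition _ _ hc, map_smul, smul_eq_mul]
  congr 1
  change _ = fderiv ℂ (g ∘ transition i j) p (w p)
  rw [h1.fderiv]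
  rfl

/-- The transformation law of `σ_W` under a change of charts and multiplication of the vector field
by the function `h`. -/
theorem sigma_pushField {n k : ℕ} {h : (Fin 2 → ℂ) → ℂ} {w : (Fin 2 → ℂ) → (Fin 2 → ℂ)}
    (s : Module.Basis (Fin (k + 1)) ℂ (homogeneousSubmodule (Fin 3) ℂ n))
    (hh : AnalyticAt ℂ h p) (hw : AnalyticAt ℂ w p) (hc : chartPt i p j ≠ 0) :
    sigma s j (pushField i j h w) (transition i j p) =
      ((chartPt i p j ^ n)⁻¹) ^ (k + 1) * h p ^ (k * (k + 1) / 2) * sigma s i w p := by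
  have hloc (x : Fin 3) (b : Fin (k + 1)) (q : Fin 2 → ℂ) :
      AnalyticAt ℂ (localExpr x (s b : MvPolynomial (Fin 3) ℂ)) q :=
    AnalyticAt.aeval_mvPolynomial (fun l => analyticAt_chartPt x l q)
      (s b : MvPolynomial (Fin 3) ℂ)
  have hW := analyticAt_pushField hh hw hc
  have key := det_of_ladder hw (f := fun _ => h) (m := fun _ _ => 0) (fun _ => hh)
    (fun _ => analyticAt_const) (h := fun y => (chartPt i y j ^ n)⁻¹)
    (((analyticAt_chartPt i j p).pow n).inv (pow_ne_zero n hc))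
    (S := fun b : Fin (k + 1) => localExpr i (s b : MvPolynomial (Fin 3) ℂ)) (fun b => hloc i b p)
    (R := fun a b y => (act (pushField i j h w))^[a] (localExpr j (s b : MvPolynomial (Fin 3) ℂ))
      (transition i j y))
    (fun b => by
      filter_upwards [eventually_chartPt_ne_zero hc] with y hy
      simp only [Function.iterate_zero, id, Pi.mul_apply, localExpr]
      rw [eval_chartPt_eq (s b).2 hy, inv_mul_cancel_left₀ (pow_ne_zero n hy)])
    (fun a b => by
      have hev := (analyticAt_transition hc).continuousAt.eventually
        (analyticAt_act_iterate hW (hloc j b _) a).eventually_analyticAt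
      filter_upwards [eventually_chartPt_ne_zero hc, hev] with y hy hy2
      rw [Function.iterate_succ_apply', act_pushField hy2.differentiableAt hy]
      simp)
  refine Eq.trans ?_ (key.trans ?_)
  · rfl
  · congr 2
    simp only [Finset.prod_const, Finset.card_range]
    rw [Fin.prod_univ_eq_prod_range (fun a => h p ^ a) (k + 1), Finset.prod_pow_eq_pow_sum,
      Finset.sum_range_id, Nat.add_sub_cancel, mul_comm k]

theorem pushSym_vector (i j : Fin 3) (p z : Fin 2 → ℂ) :
    pushSym i j p (∑ l, C (z l) * X l) = ∑ l, C (fderiv ℂ (transition i j) p z l) * X l := by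
  have : z = ∑ l, z l • Pi.single l 1 := by
    funext x
    fin_cases x <;> simp
  conv_rhs => rw [this]
  simp [pushSym, Fin.sum_univ_two]
  simp only [← algebraMap_eq]
  ring

/-- Every index occurs in `d - 1` of the unordered pairs. -/
theorem prod_prod_Ioi_mul {d : ℕ} (η : Fin d → ℂ) :
    ∏ a, ∏ b ∈ Finset.Ioi a, (η a * η b) = (∏ a, η a) ^ (d - 1) := by
  rw [Finset.prod_prod_Ioi_mul_eq_prod_prod_off_diag fun _ a => η a]
  simp [Finset.card_compl, Finset.prod_pow]

theorem disc_pushField {d : ℕ} (η : Fin d → (Fin 2 → ℂ) → ℂ)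
    (w : Fin d → (Fin 2 → ℂ) → (Fin 2 → ℂ)) (hc : chartPt i p j ≠ 0) :
    disc (fun a => pushField i j (η a) (w a)) (transition i j p) =
      ((∏ a, η a p) ^ (d - 1)) ^ 2 * (chartPt i p j ^ (-3 : ℤ)) ^ (d * (d - 1)) * disc w p := by
  have h1 (a b : Fin d) :
      (pushField i j (η a) (w a) (transition i j p) 0 *
          pushField i j (η b) (w b) (transition i j p) 1 -
        pushField i j (η a) (w a) (transition i j p) 1 *
          pushField i j (η b) (w b) (transition i j p) 0) ^ 2 =
        (η a p * η b p) ^ 2 * ((chartPt i p j ^ (-3 : ℤ)) * (chartPt i p j ^ (-3 : ℤ))) *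
          (w a p 0 * w b p 1 - w a p 1 * w b p 0) ^ 2 := by
    simp only [pushField_transition _ _ hc, Pi.smul_apply, smul_eq_mul]
    linear_combination (η a p * η b p) ^ 2 * wedge_fderiv_transition hc (w a p) (w b p)
  simp only [disc, h1, Finset.prod_mul_distrib, Finset.prod_pow]
  congr 2
  · rw [← prod_prod_Ioi_mul]
    simp only [Finset.prod_mul_distrib]
  · simp only [← Finset.prod_mul_distrib]
    rw [prod_prod_Ioi_mul (fun _ => chartPt i p j ^ (-3 : ℤ))]
    simp [pow_mul]

/-- The integer `N` such that the extactic section is a section of `O(N)`, for a section of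
`Sym^d T ⊗ O(e)`. It is an integer since `e` may be negative. -/
def extacticDegree (d n k : ℕ) (e : ℤ) : ℤ :=
  (k * (k - 1) / 2 : ℕ) * (((d - 1 : ℕ) : ℤ) * (2 * e + 3 * d)) + (k * (k + 1) / 2 : ℕ) * e +
    d * n * (k + 1)

/-- A decomposition of the web on one chart induces one on the others, and the extactic section
transforms as a section of `O(N)`, `N = extacticDegree d n k e`. -/
theorem exists_transport {d : ℕ} {e : ℤ} (hd : 1 ≤ d) {v : SymSection d e}
    {w : Fin d → (Fin 2 → ℂ) → (Fin 2 → ℂ)} (hw : IsDecomposition v i p w)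
    (hc : chartPt i p j ≠ 0) :
    ∃ w', IsDecomposition v j (transition i j p) w' ∧
      (disc w p ≠ 0 → disc w' (transition i j p) ≠ 0) ∧
      ∀ (n k : ℕ) (s : Module.Basis (Fin (k + 1)) ℂ (homogeneousSubmodule (Fin 3) ℂ n)),
        extacticValue s i w p =
          chartPt i p j ^ extacticDegree d n k e * extacticValue s j w' (transition i j p) := by
  -- The trivialization of `O(e)` is absorbed in the factor with index `0`.
  let η : Fin d → (Fin 2 → ℂ) → ℂ := fun a y => if a = ⟨0, hd⟩ then chartPt i y j ^ (-e) else 1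
  have hη (a : Fin d) : AnalyticAt ℂ (η a) p := by
    by_cases ha : a = ⟨0, hd⟩
    · simp only [η, if_pos ha]
      exact (analyticAt_chartPt i j p).zpow hc
    · simp only [η, if_neg ha]
      exact analyticAt_const
  have hprodη (y : Fin 2 → ℂ) : ∏ a, η a y = chartPt i y j ^ (-e) := by
    simp [η]
  have hdisc := disc_pushField η w hc
  rw [hprodη] at hdisc
  refine ⟨fun a => pushField i j (η a) (w a),
    ⟨fun a => analyticAt_pushField (hη a) (hw.analytic a) hc, ?_⟩, ?_, ?_⟩
  · have hc' := chartPt_transition_ne_zero hc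
    have ht := (analyticAt_transition hc').continuousAt
    have hp := transition_transition hc
    have hev : ∀ᶠ q in 𝓝 (transition j i (transition i j p)), chartPt i q j ≠ 0 ∧
        ∏ a, (∑ l, C (w a q l) * X l) = valueAt (v.loc i) q := by
      rw [hp]
      exact (eventually_chartPt_ne_zero hc).and hw.prod_eq
    filter_upwards [ht.eventually hev, eventually_chartPt_ne_zero hc'] with y hy hy'
    obtain ⟨q, hq, rfl⟩ : ∃ q, q = transition j i y ∧ y = transition i j q :=
      ⟨_, rfl, (transition_transition hy').symm⟩
    rw [← hq] at hy
    have h1 (a : Fin d) : ∑ l, C (pushField i j (η a) (w a) (transition i j q) l) * X l =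
        C (η a q) * pushSym i j q (∑ l, C (w a q l) * X l) := by
      rw [pushSym_vector, pushField_transition _ _ hy.1, Finset.mul_sum]
      refine Finset.sum_congr rfl fun l _ => ?_
      rw [Pi.smul_apply, smul_eq_mul, map_mul, mul_assoc]
    simp only [h1]
    rw [Finset.prod_mul_distrib, ← map_prod, ← map_prod, hprodη, hy.2, v.compatible i j q hy.1,
      ← mul_assoc, ← map_mul, ← zpow_add₀ hy.1, neg_add_cancel, zpow_zero, map_one, one_mul]
  · intro h
    rw [hdisc]
    exact mul_ne_zero (mul_ne_zero (pow_ne_zero _ (pow_ne_zero _ (zpow_ne_zero _ hc)))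
      (pow_ne_zero _ (zpow_ne_zero _ hc))) h
  · intro n k s
    rw [extacticValue, extacticValue, hdisc]
    simp only [sigma_pushField s (hη _) (hw.analytic _) hc]
    rw [Finset.prod_mul_distrib, Finset.prod_mul_distrib, Finset.prod_pow, Finset.prod_pow, hprodη,
      Finset.prod_const, Finset.card_univ, Fintype.card_fin]
    set c := chartPt i p j
    -- The exponents of `c` add up to zero.
    have : c ^ extacticDegree d n k e * ((((c ^ (-e)) ^ (d - 1)) ^ 2 *
        (c ^ (-3 : ℤ)) ^ (d * (d - 1))) ^ (k * (k - 1) / 2) * (((c ^ n)⁻¹ ^ d) ^ (k + 1) *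
          (c ^ (-e)) ^ (k * (k + 1) / 2))) = 1 := by
      simp only [← zpow_natCast, ← zpow_mul, ← zpow_neg, ← zpow_add₀ hc]
      rw [← zpow_zero c]
      congr 1
      rw [extacticDegree]
      push_cast
      ring
    rw [mul_pow, ← one_mul (disc w p ^ _ * _), ← this]
    ring

end Transport

/-! ### Homogenization and gluing -/

section Homogenization

theorem eq_zero_of_eventually_eval_eq_zero {P : MvPolynomial (Fin 2) ℂ} {p : Fin 2 → ℂ}
    (h : ∀ᶠ q in 𝓝 p, eval q P = 0) : P = 0 := by
  obtain ⟨ε, hε, hP⟩ := Metric.eventually_nhds_iff_ball.1 h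
  refine funext_set (fun l => Metric.ball (p l) ε)
    (fun l => infinite_of_mem_nhds (p l) (Metric.ball_mem_nhds _ hε)) fun x hx => ?_
  rw [map_zero]
  refine hP x ?_
  rw [← ball_pi p hε] at hx
  exact hx

theorem dehomogenize_X_self (i : Fin 3) : dehomogenize i (X i) = 1 := by
  simp [dehomogenize]

theorem dehomogenize_X_succAbove (i : Fin 3) (l : Fin 2) :
    dehomogenize i (X (i.succAbove l)) = X l := by
  simp [dehomogenize]

theorem dehomogenize_X_ne_zero (i l : Fin 3) : dehomogenize i (X l) ≠ 0 := by
  refine Fin.succAboveCases i ?_ (fun l => ?_) l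
  · rw [dehomogenize_X_self]; exact one_ne_zero
  · rw [dehomogenize_X_succAbove]; exact X_ne_zero l

/-- A polynomial on a chart is the dehomogenization of a homogeneous polynomial of every
sufficiently large degree. -/
theorem exists_homogenization (i : Fin 3) (g : MvPolynomial (Fin 2) ℂ) :
    ∃ D₀ : ℕ, ∀ D, D₀ ≤ D → ∃ F : MvPolynomial (Fin 3) ℂ, F.IsHomogeneous D ∧
      dehomogenize i F = g := by
  induction g using MvPolynomial.induction_on with
  | C a =>
    refine ⟨0, fun D _ => ⟨C a * X i ^ D, ?_, ?_⟩⟩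
    · simpa using (isHomogeneous_C (Fin 3) a).mul (isHomogeneous_X_pow i D)
    · rw [map_mul, map_pow, dehomogenize_X_self, one_pow, mul_one]
      exact (dehomogenize i).commutes a
  | add P Q hP hQ =>
    obtain ⟨A, hA⟩ := hP
    obtain ⟨B, hB⟩ := hQ
    refine ⟨max A B, fun D hD => ?_⟩
    obtain ⟨F, hF, rfl⟩ := hA D ((le_max_left _ _).trans hD)
    obtain ⟨G, hG, rfl⟩ := hB D ((le_max_right _ _).trans hD)
    exact ⟨F + G, hF.add hG, map_add _ _ _⟩
  | mul_X P l hP =>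
    obtain ⟨A, hA⟩ := hP
    refine ⟨A + 1, fun D hD => ?_⟩
    obtain ⟨D, rfl⟩ := Nat.exists_eq_add_of_le' (Nat.le_of_add_left_le hD)
    obtain ⟨F, hF, rfl⟩ := hA D (by omega)
    exact ⟨F * X (i.succAbove l), hF.mul (isHomogeneous_X ℂ _),
      by rw [map_mul, dehomogenize_X_succAbove]⟩

theorem eval_eq_pow_mul_eval_dehomogenize {F : MvPolynomial (Fin 3) ℂ} {D : ℕ}
    (hF : F.IsHomogeneous D) {i : Fin 3} {x : Fin 3 → ℂ} (hx : x i ≠ 0) :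
    eval x F = x i ^ D * eval (fun l => x (i.succAbove l) / x i) (dehomogenize i F) := by
  rw [eval_dehomogenize, ← eval_smul_of_isHomogeneous hF]
  congr 2
  funext l
  refine Fin.succAboveCases i ?_ (fun l => ?_) l
  · rw [Pi.smul_apply, chartPt_self, smul_eq_mul, mul_one]
  · rw [Pi.smul_apply, chartPt_succAbove, smul_eq_mul, mul_div_cancel₀ _ hx]

theorem eq_of_eval_eq_of_apply_ne_zero {F G : MvPolynomial (Fin 3) ℂ} (i : Fin 3)
    (h : ∀ x : Fin 3 → ℂ, x i ≠ 0 → eval x F = eval x G) : F = G :=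
  funext_set (fun _ => {0}ᶜ) (fun _ => (Set.finite_singleton _).infinite_compl) fun x hx =>
    h x (hx i (Set.mem_univ i))

theorem X_pow_mul_eq_of_dehomogenize_eq {F G : MvPolynomial (Fin 3) ℂ} {A B : ℕ}
    (hF : F.IsHomogeneous A) (hG : G.IsHomogeneous B) {i : Fin 3}
    (h : dehomogenize i F = dehomogenize i G) : X i ^ B * F = X i ^ A * G := by
  refine eq_of_eval_eq_of_apply_ne_zero i fun x hx => ?_
  rw [map_mul, map_mul, map_pow, map_pow, eval_X, eval_eq_pow_mul_eval_dehomogenize hF hx,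
    eval_eq_pow_mul_eval_dehomogenize hG hx, h]
  ring

/-- If the equation of a curve on the chart `U_i` vanishes on the line `X_j = 0`, then the curve
contains this line. -/
theorem X_dvd_of_dehomogenize_X_dvd {F : MvPolynomial (Fin 3) ℂ} {D : ℕ} (hF : F.IsHomogeneous D)
    {i j : Fin 3} (hij : i ≠ j) (h : dehomogenize i (X j) ∣ dehomogenize i F) : X j ∣ F := by
  -- `ρ` is the restriction to the line `X_j = 0`.
  set ρ : MvPolynomial (Fin 3) ℂ →ₐ[ℂ] MvPolynomial (Fin 3) ℂ :=
    aeval fun l => if l = j then 0 else X l with hρ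
  have h1 (G : MvPolynomial (Fin 3) ℂ) : X j ∣ G - ρ G := by
    induction G using MvPolynomial.induction_on with
    | C a => simp [hρ, ← algebraMap_eq]
    | add P Q hP hQ =>
      rw [map_add, add_sub_add_comm]
      exact dvd_add hP hQ
    | mul_X P l hP =>
      have hl : X j ∣ X l - ρ (X l) := by
        by_cases hlj : l = j
        · simp [hρ, hlj]
        · simp [hρ, hlj]
      rw [map_mul, show P * X l - ρ P * ρ (X l) = (P - ρ P) * X l + ρ P * (X l - ρ (X l)) by ring]
      exact dvd_add (hP.mul_right _) (hl.mul_left _)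
  have h2 : ρ F = 0 := by
    refine eq_of_eval_eq_of_apply_ne_zero i fun x hx => ?_
    have h3 (G : MvPolynomial (Fin 3) ℂ) :
        eval x (ρ G) = eval (fun l => if l = j then 0 else x l) G := by
      induction G using MvPolynomial.induction_on with
      | C a => simp [hρ]
      | add P Q hP hQ => simp only [map_add, hP, hQ]
      | mul_X P l hP =>
        rw [map_mul, map_mul, hP, map_mul, hρ, aeval_X, eval_X]
        split_ifs <;> simp
    have hx' : (fun l => if l = j then (0 : ℂ) else x l) i ≠ 0 := by simpa [hij] using hx
    obtain ⟨Q, hQ⟩ := h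
    rw [h3, eval_eq_pow_mul_eval_dehomogenize hF hx', hQ, map_mul, map_zero]
    obtain ⟨l, rfl⟩ := Fin.exists_succAbove_eq hij.symm
    rw [dehomogenize_X_succAbove, eval_X]
    simp
  simpa [h2] using h1 F

theorem isHomogeneous_of_X_mul {G : MvPolynomial (Fin 3) ℂ} {D : ℕ} {j : Fin 3}
    (h : (X j * G).IsHomogeneous D) (hG : G ≠ 0) : ∃ D', D = D' + 1 ∧ G.IsHomogeneous D' := by
  have h1 {m : Fin 3 →₀ ℕ} (hm : coeff m G ≠ 0) : Finsupp.weight 1 m + 1 = D := by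
    rw [← coeff_X_mul m j] at hm
    have hj : Finsupp.weight (1 : Fin 3 → ℕ) (Finsupp.single j 1) = 1 := by
      simp [Finsupp.weight_apply]
    rw [← h hm, map_add, hj, add_comm]
  obtain ⟨m, hm⟩ := exists_coeff_ne_zero hG
  exact ⟨_, (h1 hm).symm, fun m' hm' => Nat.add_right_cancel ((h1 hm').trans (h1 hm).symm)⟩

/-- Regular functions on the charts that agree, as sections of `O(N)`, near one point of each chart
come from a homogeneous polynomial of degree `N`. In particular `N` is not negative. -/
theorem exists_isHomogeneous_of_gluing {N : ℤ} {g : Fin 3 → MvPolynomial (Fin 2) ℂ}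
    (hg : g 0 ≠ 0) (hglue : ∀ i, ∃ p, ∀ᶠ q in 𝓝 p,
      chartPt i q 0 ≠ 0 ∧ eval q (g i) = chartPt i q 0 ^ N * eval (transition i 0 q) (g 0)) :
    ∃ (D : ℕ) (F : MvPolynomial (Fin 3) ℂ), (D : ℤ) = N ∧ F.IsHomogeneous D ∧
      ∀ i, dehomogenize i F = g i := by
  classical
  -- Take a homogenization of `g 0` of least degree `D ≥ N`. If `D > N`, then on the chart `U_1` it
  -- vanishes on `X_0 = 0`, and division by `X_0` gives one of smaller degree.
  have hex : ∃ D : ℕ, N ≤ D ∧ ∃ F : MvPolynomial (Fin 3) ℂ, F.IsHomogeneous D ∧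
      dehomogenize 0 F = g 0 := by
    obtain ⟨D₀, hD₀⟩ := exists_homogenization 0 (g 0)
    exact ⟨max D₀ N.toNat, by omega, hD₀ _ (le_max_left _ _)⟩
  obtain ⟨hND, F, hF, hF0⟩ := Nat.find_spec hex
  have hmin := fun D => Nat.find_min (m := D) hex
  generalize Nat.find hex = D at hND hF hmin
  obtain ⟨t, ht⟩ := Int.le.dest hND
  have hFi (i : Fin 3) : dehomogenize i F = dehomogenize i (X 0) ^ t * g i := by
    obtain ⟨p, hp⟩ := hglue i
    rw [← sub_eq_zero]
    refine eq_zero_of_eventually_eval_eq_zero (p := p) ?_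
    filter_upwards [hp] with q hq
    rw [map_sub, map_mul, map_pow, eval_dehomogenize, eval_dehomogenize, eval_X, hq.2,
      eval_chartPt_eq hF hq.1, ← eval_dehomogenize, hF0, ← mul_assoc, ← zpow_natCast,
      ← zpow_natCast, ← zpow_add₀ hq.1, ← ht, add_comm, sub_self]
  rcases Nat.eq_zero_or_pos t with rfl | htpos
  · exact ⟨D, F, by omega, hF, fun i => by rw [hFi, pow_zero, one_mul]⟩
  · exfalso
    obtain ⟨G, rfl⟩ := X_dvd_of_dehomogenize_X_dvd (i := 1) (j := 0) hF (by decide)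
      (by rw [hFi]; exact (dvd_pow_self _ htpos.ne').mul_right _)
    rw [map_mul, dehomogenize_X_self, one_mul] at hF0
    obtain ⟨D', rfl, hG⟩ := isHomogeneous_of_X_mul hF (by rintro rfl; exact hg (by simp [← hF0]))
    exact hmin D' (Nat.lt_succ_self _) ⟨by omega, G, hG, hF0⟩

/-- A plane curve is determined by its equations on the charts, up to constant factors that may
depend on the chart. -/
theorem associated_of_associated_dehomogenize {F G : MvPolynomial (Fin 3) ℂ} {A B : ℕ}
    (hF : F.IsHomogeneous A) (hG : G.IsHomogeneous B) (hG0 : G ≠ 0)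
    (h : ∀ i, Associated (dehomogenize i F) (dehomogenize i G)) : Associated F G := by
  have h1 (i : Fin 3) : ∃ c : ℂ, c ≠ 0 ∧ X i ^ B * F = X i ^ A * (C c * G) := by
    obtain ⟨u, hu⟩ := (h i).symm
    obtain ⟨c, hc, hcu⟩ := MvPolynomial.isUnit_iff_eq_C_of_isReduced.1 u.isUnit
    refine ⟨c, hc.ne_zero, X_pow_mul_eq_of_dehomogenize_eq hF
      (by simpa using (isHomogeneous_C (Fin 3) c).mul hG) ?_⟩
    rw [← hu, hcu, map_mul, mul_comm]
    congr 1
    exact ((dehomogenize i).commutes c).symm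
  obtain ⟨a, ha, haF⟩ := h1 0
  obtain ⟨b, hb, hbF⟩ := h1 1
  have key : X 1 ^ B * (X 0 ^ A * C a) = X 0 ^ B * (X 1 ^ A * (C b : MvPolynomial (Fin 3) ℂ)) := by
    refine mul_right_cancel₀ hG0 ?_
    linear_combination X 0 ^ B * hbF - X 1 ^ B * haF
  have key1 := congrArg (eval ![(1 : ℂ), 1, 1]) key
  have key2 := congrArg (eval ![(2 : ℂ), 1, 1]) key
  simp at key1 key2
  have hAB : A = B := by
    rw [key1, mul_left_inj' hb] at key2
    have : (2 : ℕ) ^ A = 2 ^ B := by exact_mod_cast key2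
    exact Nat.pow_right_injective le_rfl this
  subst hAB
  have := mul_left_cancel₀ (pow_ne_zero A (X_ne_zero 0)) haF
  rw [this, mul_comm]
  exact associated_mul_unit_left G (C a) ((isUnit_iff_ne_zero.2 ha).map C)

end Homogenization

/-! ### The extactic divisor -/

section Main

theorem IsDecomposition.eventually {d : ℕ} {e : ℤ} {v : SymSection d e} {i : Fin 3}
    {p : Fin 2 → ℂ} {w : Fin d → (Fin 2 → ℂ) → (Fin 2 → ℂ)} (hw : IsDecomposition v i p w) :
    ∀ᶠ q in 𝓝 p, IsDecomposition v i q w := by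
  filter_upwards [eventually_all.2 fun a => (hw.analytic a).eventually_analyticAt,
    hw.prod_eq.eventually_nhds] with q h1 h2
  exact ⟨h1, h2⟩

theorem eventually_disc_ne_zero {d : ℕ} {p : Fin 2 → ℂ}
    {w : Fin d → (Fin 2 → ℂ) → (Fin 2 → ℂ)} (hw : ∀ a, AnalyticAt ℂ (w a) p)
    (h : disc w p ≠ 0) : ∀ᶠ q in 𝓝 p, disc w q ≠ 0 := by
  have hcomp (b : Fin d) (l : Fin 2) : AnalyticAt ℂ (fun y => w b y l) p :=
    analyticAt_pi_iff.1 (hw b) l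
  have : AnalyticAt ℂ (disc w) p := by
    unfold disc
    exact Finset.analyticAt_fun_prod _ fun a _ => Finset.analyticAt_fun_prod _ fun b _ =>
      (((hcomp a 0).mul (hcomp b 1)).sub ((hcomp a 1).mul (hcomp b 0))).pow 2
  exact this.continuousAt.eventually_ne h

/-- If the extactic section does not vanish identically, then on every chart it is nonzero at some
point off the discriminant and off the coordinate lines at which the web decomposes. -/
theorem exists_decomposition {d n k : ℕ} {e : ℤ} (hd : 1 ≤ d) (hn : 1 ≤ n) {v : SymSection d e}
    {s : Module.Basis (Fin (k + 1)) ℂ (homogeneousSubmodule (Fin 3) ℂ n)}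
    (hE : ¬ ExtacticVanishes v s) (i : Fin 3) :
    ∃ p w, IsDecomposition v i p w ∧ disc w p ≠ 0 ∧ extacticValue s i w p ≠ 0 ∧
      ∀ j, chartPt i p j ≠ 0 := by
  simp only [ExtacticVanishes, not_forall] at hE
  obtain ⟨i₀, p₀, w, hw, hval⟩ := hE
  -- As `n ≥ 1`, the exponent of the discriminant is positive, so that a nonzero value of the
  -- section forces the discriminant to be nonzero.
  have hK : k * (k - 1) / 2 ≠ 0 := by
    have hk : 2 ≤ k := by
      have := two_mul_card_basis s
      nlinarith
    have : 2 * 1 ≤ k * (k - 1) := Nat.mul_le_mul hk (by omega)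
    omega
  have hdisc : disc w p₀ ≠ 0 := fun h => hval (by
    rw [extacticValue, h, zero_pow hK, zero_mul])
  obtain ⟨g, hg⟩ := exists_eval_eq_extacticValue hd v s i₀
  have hval' : ∀ᶠ q in 𝓝 p₀, eval q g ≠ 0 :=
    (AnalyticOnNhd.eval_mvPolynomial g p₀ (Set.mem_univ _)).continuousAt.eventually_ne
      (by rwa [hg _ _ hw])
  have hfreq : ∃ᶠ q in 𝓝 p₀, eval q (∏ l, dehomogenize i₀ (X l)) ≠ 0 := fun h =>
    Finset.prod_ne_zero_iff.2 (fun l _ => dehomogenize_X_ne_zero i₀ l)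
      (eq_zero_of_eventually_eval_eq_zero (p := p₀) (by simpa using h))
  obtain ⟨q, hq, hqw, hqd, hqv⟩ := (hfreq.and_eventually
    (hw.eventually.and ((eventually_disc_ne_zero hw.analytic hdisc).and hval'))).exists
  have hq' (l : Fin 3) : chartPt i₀ q l ≠ 0 := by
    rw [map_prod] at hq
    have := Finset.prod_ne_zero_iff.1 hq l (Finset.mem_univ l)
    rwa [eval_dehomogenize, eval_X] at this
  obtain ⟨w', hw', hd', hv'⟩ := exists_transport hd hqw (hq' i)
  refine ⟨_, w', hw', hd' hqd, fun h => hqv ?_, fun l => ?_⟩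
  · rw [hg _ _ hqw, hv' n k s, h, mul_zero]
  · rw [chartPt_transition (hq' i)]
    exact div_ne_zero (hq' l) (hq' i)

theorem extacticDegree_eq {d r n k : ℕ} (hd : 1 ≤ d) (hk : 2 * (k + 1) = (n + 1) * (n + 2)) :
    ((extacticDegree d n k ((r : ℤ) - (d : ℤ)) : ℤ) : ℚ) = (n : ℚ) / 8 *
        (((n : ℚ) + 1) * ((n : ℚ) + 2) * (4 * (d : ℚ) + ((n : ℚ) + 3) * ((r : ℚ) - (d : ℚ))) +
          ((n : ℚ) + 3) * ((n : ℚ) ^ 2 + 3 * (n : ℚ) - 2) * ((d : ℚ) - 1) *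
            ((d : ℚ) + 2 * (r : ℚ))) := by
  have hkq : (k : ℚ) = n * (n + 3) / 2 := by
    have : (2 : ℚ) * (k + 1) = (n + 1) * (n + 2) := by exact_mod_cast hk
    linear_combination this / 2
  have h1 : ((k * (k - 1) / 2 : ℕ) : ℚ) = k * (k - 1) / 2 := by
    rw [Nat.cast_div_charZero (Nat.even_mul_pred_self k).two_dvd]
    cases k <;> simp
  have h2 : ((k * (k + 1) / 2 : ℕ) : ℚ) = k * (k + 1) / 2 := by
    rw [Nat.cast_div_charZero (Nat.even_mul_succ_self k).two_dvd]
    simp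
  have h3 : ((d - 1 : ℕ) : ℚ) = d - 1 := by
    rw [Nat.cast_sub hd, Nat.cast_one]
  rw [extacticDegree, Int.cast_add, Int.cast_add, Int.cast_mul (k * (k - 1) / 2 : ℕ),
    Int.cast_mul (k * (k + 1) / 2 : ℕ), Int.cast_natCast, Int.cast_natCast, h1, h2]
  push_cast
  rw [h3, hkq]
  ring

end Main

end Extactic

theorem theorem1 (d r n k : ℕ) (hd : 1 ≤ d) (hn : 1 ≤ n)
    (v : Extactic.WebSection d r)
    (s : Module.Basis (Fin (k + 1)) ℂ (MvPolynomial.homogeneousSubmodule (Fin 3) ℂ n))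
    (hE : ¬ Extactic.ExtacticVanishes v s) :
    ∃ E : Extactic.PlaneCurve, Extactic.IsExtacticDivisor v s E ∧
      (∀ E' : Extactic.PlaneCurve, Extactic.IsExtacticDivisor v s E' →
        Associated E'.poly E.poly) ∧
      (E.degree : ℚ) = (n : ℚ) / 8 *
        (((n : ℚ) + 1) * ((n : ℚ) + 2) * (4 * (d : ℚ) + ((n : ℚ) + 3) * ((r : ℚ) - (d : ℚ))) +
          ((n : ℚ) + 3) * ((n : ℚ) ^ 2 + 3 * (n : ℚ) - 2) * ((d : ℚ) - 1) *
            ((d : ℚ) + 2 * (r : ℚ))) := by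
  choose g hg using Extactic.exists_eval_eq_extacticValue hd v s
  have hg0 : g 0 ≠ 0 := by
    obtain ⟨p, w, hw, -, hval, -⟩ := Extactic.exists_decomposition hd hn hE 0
    intro h
    exact hval (by rw [← hg 0 p w hw, h, map_zero])
  obtain ⟨D, F, hD, hF, hFg⟩ := Extactic.exists_isHomogeneous_of_gluing
    (N := Extactic.extacticDegree d n k ((r : ℤ) - d)) hg0 fun i => by
      obtain ⟨p, w, hw, -, -, hc⟩ := Extactic.exists_decomposition hd hn hE i
      refine ⟨p, ?_⟩
      filter_upwards [hw.eventually, Extactic.eventually_chartPt_ne_zero (hc 0)] with q hq hq0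
      obtain ⟨w', hw', -, hv'⟩ := Extactic.exists_transport hd hq hq0
      exact ⟨hq0, by rw [hg i q w hq, hg 0 _ w' hw', hv' n k s]⟩
  have hF0 : F ≠ 0 := by
    rintro rfl
    exact hg0 (by rw [← hFg 0, map_zero])
  refine ⟨⟨F, D, hF, hF0⟩, fun i => ⟨g i, fun p w hw _ => hg i p w hw, ?_⟩, fun E' hE' => ?_, ?_⟩
  · rw [hFg i]
  · refine Extactic.associated_of_associated_dehomogenize E'.homogeneous hF hF0 fun i => ?_
    obtain ⟨g', hg', hass⟩ := hE' i
    have : g' = g i := by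
      obtain ⟨p, w, hw, hdisc, -, -⟩ := Extactic.exists_decomposition hd hn hE i
      rw [← sub_eq_zero]
      refine Extactic.eq_zero_of_eventually_eval_eq_zero (p := p) ?_
      filter_upwards [hw.eventually, Extactic.eventually_disc_ne_zero hw.analytic hdisc]
        with q h1 h2
      rw [map_sub, hg' q w h1 h2, hg i q w h1, sub_self]
    rw [hFg i, ← this]
    exact hass
  · rw [← Extactic.extacticDegree_eq hd (Extactic.two_mul_card_basis s), ← hD, Int.cast_natCast]
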